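/- There is an absolute constant $C>0$ such that the following holds for all integers $n,k\ge 0$. Let $B_c(0,\rho)\subset\mathbb C^n$ be the open Euclidean ball of radius $\rho$ centred at $0$, let $r>1$, and let $f$ be holomorphic on $B_c(0,r)$. The Chebyshev degree $d_f(r)$ of $f$ in $B_c(0,1)$ is the optimal (that is, the infimum in $[0,\infty]$ of all) $d>0$ such that $$\sup_I|f|\le\left(\frac{4|I|}{|\omega|}\right)^{d}\sup_\omega|f|$$ for every real segment $I\subset B_c(0,1)$ and every measurable $\omega\subset I$ of positive length, where $|\cdot|$ is length and $\mathbb C^n\cong\mathbb R^{2n}$. Let $\mathbb R^k\subset\mathbb C^n$ be a $k$-dimensional real affine subspace, let $V\subset B_c(0,1)\cap\mathbb R^k$ be a $k$-dimensional convex body (a convex set with nonempty interior in $\mathbb R^k$), and let $h:\mathbb R^k\to[0,\infty)$ be a log-concave function (that is, $K=\{h>0\}$ is convex and $\log h$ is concave on $K$) which vanishes outside $V$. Let $\mu_h$ be the measure on $\mathbb R^k$ with density $h$ with respect to Lebesgue measure, put $|V|:=\mu_h(V)$, and assume $0<|V|<\infty$ and that $f$ does not vanish identically on $V$. Then $\log|f|$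 is $\mu_h$-integrable on $V$ and, with $C_V(f):=\frac1{|V|}\int_V\log|f|\,d\mu_h$, $$\frac{1}{|V|}\int_V\bigl|\log|f|-C_V(f)\bigr|\,d\mu_h\le C\,d_f(r).$$ -/

import Mathlib

open MeasureTheory Metric Set
open scoped ENNReal NNReal

/-- The Remez-type inequality with exponent `d` on all real segments of the open unit ball of `ℂⁿ`:
`sup_I |f| ≤ (4 |I| / |ω|) ^ d * sup_ω |f|`.
The segment `I = [a, b]` is parametrized affinely by `[0, 1]`, and `ω` is the image of a measurable
set `S ⊆ [0, 1]` of positive measure, so that `|I| / |ω| = 1 / volume S`.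
(For `a = b` the inequality holds trivially.) -/
def RemezInequality {n : ℕ} (f : EuclideanSpace ℂ (Fin n) → ℂ) (d : ℝ≥0) : Prop :=
  ∀ a ∈ ball (0 : EuclideanSpace ℂ (Fin n)) 1, ∀ b ∈ ball (0 : EuclideanSpace ℂ (Fin n)) 1,
    ∀ S : Set ℝ, S ⊆ Icc 0 1 → MeasurableSet S → 0 < volume S →
      (⨆ t ∈ Icc (0 : ℝ) 1, ‖f (AffineMap.lineMap a b t)‖ₑ) ≤
        (4 / volume S) ^ (d : ℝ) * ⨆ t ∈ S, ‖f (AffineMap.lineMap a b t)‖ₑ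

/-- The Chebyshev degree of `f` in the open unit ball of `ℂⁿ`: the optimal (smallest) exponent in the
Remez-type inequality, as an infimum in `[0, ∞]`. -/
noncomputable def chebyshevDegree {n : ℕ} (f : EuclideanSpace ℂ (Fin n) → ℂ) : ℝ≥0∞ :=
  ⨅ (d : ℝ≥0) (_ : 0 < d ∧ RemezInequality f d), (d : ℝ≥0∞)

/-- A nonnegative function on `ℝᵏ` is log-concave if the set where it is positive is convex and its
logarithm is concave there (`ConcaveOn` contains the convexity of the set). -/
structure IsLogConcave {k : ℕ} (h : EuclideanSpace ℝ (Fin k) → ℝ) : Prop where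
  nonneg : ∀ x, 0 ≤ h x
  concaveOn_log : ConcaveOn ℝ {x | 0 < h x} (fun x => Real.log (h x))

/-- The measure on `ℝᵏ` with density `h` with respect to Lebesgue measure. -/
noncomputable def densityMeasure {k : ℕ} (h : EuclideanSpace ℝ (Fin k) → ℝ) :
    Measure (EuclideanSpace ℝ (Fin k)) :=
  volume.withDensity (fun x => ENNReal.ofReal (h x))

/-! Let μ be the probability measure with the normalised density p. On a segment from x to y the
Remez inequality says that if |f(y)| ≥ α e^{ds}, then |f| ≤ α on a proportion at most 4e^{-s} of the
segment (`RemezInequality.volume_sublevel_le`). The point is to turn this into tail bounds for μ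
with constants independent of the dimension.

The tool is displacement interpolation. Let D have mass δ > 0, let X have law μ and Y the law of μ
conditioned on D, coupled coordinate by coordinate through conditional quantiles
(`exists_interpolation_coupling`). A change of variables and the AM-GM inequality show that (1-t)X +
tY has density at most δ^{-t} p. If every segment from {p ≠ 0} to D ∩ {p ≠ 0} spends a proportion at
most η in B, averaging over t in [0, ε] gives ε(1 - δ^{-ε}(1 - μ(B))) ≤ η (`logConcave_dilation`).

With β a median of |f|, the pairs D = {|f| ≥ βe^{ds}}, B = {|f| ≤ β} and D = {|f| ≥ β}, B = {|f| ≤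
βe^{-ds}} give exponential tails of log|f| - log β at scale d. Integrating them bounds the
oscillation around log β (`logConcave_mean_oscillation`), and passing to the mean costs a factor 2.

Integrability is proved separately, since the Chebyshev degree may be infinite. Near each point some
directional derivative of f does not vanish, so {|f| ≤ ε} has measure at most A ε^τ locally
(`exists_measure_sublevel_le`). Hence log|f| is locally Lebesgue integrable, and h is bounded
(`IsLogConcave.exists_le`). -/

/-! ### Quantile functions and interpolation on the line. -/

open Filter Topology ProbabilityTheory in
/-- A primitive of an integrable density is continuous, with the density as derivative a.e. -/
lemma lintegral_Iic_eq_ofReal {P : ℝ → ℝ≥0∞} (hP : Measurable P) (h1 : ∫⁻ x, P x = 1) :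
    ∃ F : ℝ → ℝ, Continuous F ∧ Monotone F ∧ Tendsto F atBot (𝓝 0) ∧ Tendsto F atTop (𝓝 1) ∧
      (∀ a, ∫⁻ x in Iic a, P x = ENNReal.ofReal (F a)) ∧ (∀ a, 0 ≤ F a) ∧
      ∀ᵐ x, HasDerivAt F (P x).toReal x := by
  have : IsProbabilityMeasure (volume.withDensity P) := ⟨by simpa using h1⟩
  have hfin : ∀ᵐ x, P x < ∞ := ae_lt_top hP (by simp [h1])
  have hint : Integrable (fun x => (P x).toReal) :=
    integrable_toReal_of_lintegral_ne_top hP.aemeasurable (by simp [h1])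
  have hF : ∀ a, ∫⁻ x in Iic a, P x = ENNReal.ofReal (cdf (volume.withDensity P) a) := fun a => by
    rw [ofReal_cdf, withDensity_apply _ measurableSet_Iic]
  have hF' : ∀ a, cdf (volume.withDensity P) a = ∫ x in Iic a, (P x).toReal := fun a => by
    rw [integral_toReal hP.aemeasurable (ae_restrict_of_ae hfin), hF,
      ENNReal.toReal_ofReal (cdf_nonneg _ _)]
  have hF2 : (cdf (volume.withDensity P) : ℝ → ℝ) =
      fun a => cdf (volume.withDensity P) 0 + ∫ x in (0 : ℝ)..a, (P x).toReal := by
    ext a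
    rw [hF', hF', ← intervalIntegral.integral_Iic_sub_Iic hint.integrableOn hint.integrableOn]
    ring
  refine ⟨cdf (volume.withDensity P), ?_, monotone_cdf _, tendsto_cdf_atBot _, tendsto_cdf_atTop _,
    hF, cdf_nonneg _, ?_⟩
  · rw [hF2]
    exact continuous_const.add (intervalIntegral.continuous_primitive
      (fun a b => hint.intervalIntegrable) 0)
  · filter_upwards [_root_.LocallyIntegrable.ae_hasDerivAt_integral hint.locallyIntegrable] with x hx
    rw [hF2]
    exact (hx 0).const_add _

/-- The quantile function of a probability density on the line. -/
noncomputable def quantile (P : ℝ → ℝ≥0∞) (u : ℝ) : ℝ :=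
  sInf {a : ℝ | ENNReal.ofReal u ≤ ∫⁻ x in Iic a, P x}

-- The distribution function F is continuous and monotone with limits 0 and 1, so for 0 < u < 1 the
-- set {u ≤ F} is closed, nonempty and bounded below, and its infimum is attained.
open Filter Topology in
lemma quantile_le_iff {P : ℝ → ℝ≥0∞} (hP : Measurable P) (h1 : ∫⁻ x, P x = 1) {u : ℝ}
    (hu : u ∈ Ioo (0 : ℝ) 1) (a : ℝ) :
    quantile P u ≤ a ↔ ENNReal.ofReal u ≤ ∫⁻ x in Iic a, P x := by
  obtain ⟨F, hc, hm, hb, ht, hF, h0, -⟩ := lintegral_Iic_eq_ofReal hP h1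
  have hS : {a : ℝ | ENNReal.ofReal u ≤ ∫⁻ x in Iic a, P x} = {a | u ≤ F a} := by
    ext a
    simp only [mem_ofPred_eq, hF, ENNReal.ofReal_le_ofReal_iff (h0 a)]
  rw [hF, ENNReal.ofReal_le_ofReal_iff (h0 a), quantile, hS]
  have hcl : IsClosed {a | u ≤ F a} := isClosed_le continuous_const hc
  have hbd : BddBelow {a | u ≤ F a} := by
    obtain ⟨b, hb⟩ := ((tendsto_order.1 hb).2 u hu.1).exists
    exact ⟨b, fun a ha => le_of_lt (lt_of_not_ge fun hab => (ha.trans (hm hab)).not_gt hb)⟩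
  have hne : {a | u ≤ F a}.Nonempty :=
    ((tendsto_order.1 ht).1 u hu.2).exists.imp fun _ h => h.le
  refine ⟨fun h => ?_, fun h => csInf_le hbd h⟩
  have : u ≤ F (sInf {a | u ≤ F a}) := hcl.csInf_mem hne hbd
  exact this.trans (hm h)

lemma monotoneOn_quantile {P : ℝ → ℝ≥0∞} (hP : Measurable P) (h1 : ∫⁻ x, P x = 1) :
    MonotoneOn (quantile P) (Ioo 0 1) := fun u hu v hv huv => by
  rw [quantile_le_iff hP h1 hu]
  exact (ENNReal.ofReal_le_ofReal huv).trans ((quantile_le_iff hP h1 hv _).1 le_rfl)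

/-- There are no atoms: F ≤ u to the left of the quantile, and continuity carries this to the
quantile itself. -/
lemma lintegral_Iic_quantile {P : ℝ → ℝ≥0∞} (hP : Measurable P) (h1 : ∫⁻ x, P x = 1) {u : ℝ}
    (hu : u ∈ Ioo (0 : ℝ) 1) : ∫⁻ x in Iic (quantile P u), P x = ENNReal.ofReal u := by
  refine le_antisymm ?_ ((quantile_le_iff hP h1 hu _).1 le_rfl)
  have hq := quantile_le_iff hP h1 hu
  obtain ⟨F, hc, -, -, -, hF, h0, -⟩ := lintegral_Iic_eq_ofReal hP h1
  simp only [hF] at hq ⊢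
  refine ENNReal.ofReal_le_ofReal ?_
  refine le_of_tendsto (hc.continuousWithinAt (s := Iio (quantile P u)) (x := quantile P u)) ?_
  filter_upwards [self_mem_nhdsWithin] with a ha
  by_contra! h
  exact absurd ((hq a).2 (ENNReal.ofReal_le_ofReal h.le)) (not_le.2 ha)

lemma strictMonoOn_quantile {P : ℝ → ℝ≥0∞} (hP : Measurable P) (h1 : ∫⁻ x, P x = 1) :
    StrictMonoOn (quantile P) (Ioo 0 1) := by
  refine (monotoneOn_quantile hP h1).strictMonoOn_of_injOn fun u hu v hv huv => ?_
  have := lintegral_Iic_quantile hP h1 hu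
  rwa [huv, lintegral_Iic_quantile hP h1 hv, eq_comm,
    ENNReal.ofReal_eq_ofReal_iff hu.1.le hv.1.le] at this

lemma aemeasurable_quantile {P : ℝ → ℝ≥0∞} (hP : Measurable P) (h1 : ∫⁻ x, P x = 1) :
    AEMeasurable (quantile P) (volume.restrict (Ioo 0 1)) :=
  aemeasurable_restrict_of_monotoneOn measurableSet_Ioo (monotoneOn_quantile hP h1)

/-- The quantile function pushes the uniform measure forward to the given density. -/
lemma map_quantile {P : ℝ → ℝ≥0∞} (hP : Measurable P) (h1 : ∫⁻ x, P x = 1) :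
    (volume.restrict (Ioo (0 : ℝ) 1)).map (quantile P) = volume.withDensity P := by
  have : IsProbabilityMeasure (volume.withDensity P) := ⟨by simpa using h1⟩
  have : IsProbabilityMeasure (volume.restrict (Ioo (0 : ℝ) 1)) := ⟨by simp⟩
  have := Measure.isProbabilityMeasure_map (aemeasurable_quantile hP h1)
  refine Measure.ext_of_Iic _ _ fun a => ?_
  rw [Measure.map_apply_of_aemeasurable (aemeasurable_quantile hP h1) measurableSet_Iic,
    withDensity_apply _ measurableSet_Iic, Measure.restrict_apply' measurableSet_Ioo]
  have hle : ∫⁻ x in Iic a, P x ≤ 1 := h1 ▸ setLIntegral_le_lintegral _ _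
  have hne := ne_top_of_le_ne_top ENNReal.one_ne_top hle
  set c := (∫⁻ x in Iic a, P x).toReal with hc
  have hc1 : c ≤ 1 := ENNReal.toReal_le_of_le_ofReal zero_le_one (by simpa using hle)
  have : quantile P ⁻¹' Iic a ∩ Ioo 0 1 = Iic c ∩ Ioo 0 1 := by
    ext u
    refine and_congr_left fun hu => ?_
    rw [mem_preimage, mem_Iic, quantile_le_iff hP h1 hu, mem_Iic, ENNReal.ofReal_le_iff_le_toReal hne]
  rw [this]
  refine le_antisymm ((measure_mono (t := Ioc 0 c) fun u hu => ⟨hu.2.1, hu.1⟩).trans ?_) ?_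
  · simp [hc, hne]
  · refine le_trans ?_ (measure_mono (s := Ioo 0 c) fun u hu => ⟨hu.2.le, hu.1, hu.2.trans_le hc1⟩)
    simp [hc, hne]

/-- Almost everywhere the quantile function has the reciprocal of the density as derivative. -/
lemma ae_hasDerivAt_quantile {P : ℝ → ℝ≥0∞} (hP : Measurable P) (h1 : ∫⁻ x, P x = 1) :
    ∀ᵐ u ∂(volume.restrict (Ioo (0 : ℝ) 1)), 0 < P (quantile P u) ∧ P (quantile P u) < ∞ ∧
      HasDerivAt (quantile P) (P (quantile P u)).toReal⁻¹ u := by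
  have hq := @quantile_le_iff P hP h1
  have hi := @lintegral_Iic_quantile P hP h1
  obtain ⟨F, hc, hm, -, -, hF, h0, hd⟩ := lintegral_Iic_eq_ofReal hP h1
  have hfin : ∀ᵐ x, P x < ∞ := ae_lt_top hP (by simp [h1])
  -- The density is positive almost everywhere for its own measure; `map_quantile` pulls these
  -- properties back to almost every u.
  have key : ∀ᵐ x ∂(volume.withDensity P), 0 < P x ∧ P x < ∞ ∧ HasDerivAt F (P x).toReal x := by
    rw [ae_withDensity_iff hP]
    filter_upwards [hfin, hd] with x h2 h3 h4 using ⟨pos_iff_ne_zero.2 h4, h2, h3⟩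
  rw [← map_quantile hP h1] at key
  filter_upwards [ae_of_ae_map (aemeasurable_quantile hP h1) key,
    ae_restrict_mem measurableSet_Ioo] with u ⟨hu1, hu2, hu3⟩ hu
  refine ⟨hu1, hu2, ?_⟩
  have hpos : 0 < (P (quantile P u)).toReal := ENNReal.toReal_pos hu1.ne' hu2.ne
  have hFq : ∀ v ∈ Ioo (0 : ℝ) 1, F (quantile P v) = v := fun v hv => by
    have := hi hv
    rwa [hF, ENNReal.ofReal_eq_ofReal_iff (h0 _) hv.1.le] at this
  have hq' : ∀ v ∈ Ioo (0 : ℝ) 1, ∀ a, quantile P v ≤ a ↔ v ≤ F a := fun v hv a => by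
    rw [hq hv, hF, ENNReal.ofReal_le_ofReal_iff (h0 _)]
  have hnhd : Ioo (0 : ℝ) 1 ∈ nhds u := isOpen_Ioo.mem_nhds hu
  refine HasDerivAt.of_local_left_inverse ?_ hu3 hpos.ne' ?_
  -- A second point of the level set {F = u} would make F constant on a nondegenerate interval
  -- ending at the quantile, against the positive derivative there. So the quantile function is
  -- continuous at u and the inverse derivative rule applies.
  · have hne : ∀ a, a ≠ quantile P u → F a ≠ u := by
      intro a ha hFa
      have hcst : ∀ b ∈ uIcc a (quantile P u), F b = u := by
        intro b hb
        rcases le_total a (quantile P u) with h | h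
        · rw [uIcc_of_le h] at hb
          exact le_antisymm ((hm hb.2).trans (hFq u hu).le) (hFa.symm.le.trans (hm hb.1))
        · rw [uIcc_of_ge h] at hb
          exact le_antisymm ((hm hb.2).trans hFa.le) ((hFq u hu).symm.le.trans (hm hb.1))
      have hud : UniqueDiffWithinAt ℝ (uIcc a (quantile P u)) (quantile P u) :=
        (uniqueDiffOn_Icc (by simp [eq_comm, ha])) _ right_mem_uIcc
      have e1 := hu3.hasDerivWithinAt (s := uIcc a (quantile P u))
      have e2 : HasDerivWithinAt F 0 (uIcc a (quantile P u)) (quantile P u) :=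
        (hasDerivWithinAt_const _ _ u).congr hcst (hcst _ right_mem_uIcc)
      exact hpos.ne' (hud.eq_deriv _ e1 e2)
    refine tendsto_order.2 ⟨fun a ha => ?_, fun a ha => ?_⟩
    · have : F a < u := lt_of_le_of_ne ((hm ha.le).trans (hFq u hu).le) (hne a ha.ne)
      filter_upwards [hnhd, lt_mem_nhds this] with v hv hv'
      exact lt_of_not_ge fun h => hv'.not_ge ((hq' v hv a).1 h)
    · obtain ⟨b, hb, hba⟩ := exists_between ha
      have : u < F b := lt_of_le_of_ne ((hFq u hu).symm.le.trans (hm hb.le)) (hne b hb.ne').symm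
      filter_upwards [hnhd, gt_mem_nhds this] with v hv hv'
      exact ((hq' v hv b).2 (le_of_lt hv')).trans_lt hba
  · filter_upwards [hnhd] with v hv using hFq v hv

/-- One-dimensional displacement convexity: the interpolation between two quantile functions
has a density at most the weighted geometric mean of the two densities. -/
lemma lintegral_quantile_interpolation_le {P Q : ℝ → ℝ≥0∞} (hP : Measurable P)
    (hP1 : ∫⁻ x, P x = 1) (hQ : Measurable Q) (hQ1 : ∫⁻ x, Q x = 1) {t : ℝ}
    (ht : t ∈ Icc (0 : ℝ) 1) (G : ℝ → ℝ≥0∞) :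
    ∫⁻ u in Ioo (0 : ℝ) 1, G ((1 - t) * quantile P u + t * quantile Q u) *
      (P (quantile P u) ^ (1 - t) * Q (quantile Q u) ^ t)⁻¹ ≤ ∫⁻ z, G z := by
  have h := (ae_hasDerivAt_quantile hP hP1).and (ae_hasDerivAt_quantile hQ hQ1)
  obtain ⟨N, hN, hNm, hN0⟩ := exists_measurable_superset_of_null (ae_iff.1 h)
  set S := Ioo (0 : ℝ) 1 \ N with hS
  have hSm : MeasurableSet S := measurableSet_Ioo.diff hNm
  have hSae : S =ᵐ[volume] Ioo (0 : ℝ) 1 := by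
    rw [Measure.restrict_apply' measurableSet_Ioo] at hN0
    refine (sdiff_subset.eventuallyLE).antisymm ?_
    rw [ae_le_set]
    refine measure_mono_null ?_ hN0
    rintro x ⟨hx, hx'⟩
    exact ⟨by_contra fun h => hx' ⟨hx, h⟩, hx⟩
  have hgood : ∀ u ∈ S, (0 < P (quantile P u) ∧ P (quantile P u) < ∞ ∧
      HasDerivAt (quantile P) (P (quantile P u)).toReal⁻¹ u) ∧
      (0 < Q (quantile Q u) ∧ Q (quantile Q u) < ∞ ∧
      HasDerivAt (quantile Q) (Q (quantile Q u)).toReal⁻¹ u) := fun u hu => by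
    by_contra hcon
    exact hu.2 (hN hcon)
  -- The interpolation is strictly increasing on S, so the change of variables formula holds without
  -- any assumption on P and Q beyond measurability and mass one.
  have hinj : InjOn (fun u => (1 - t) * quantile P u + t * quantile Q u) S := by
    refine StrictMonoOn.injOn fun u hu v hv huv => ?_
    have a1 := strictMonoOn_quantile hP hP1 hu.1 hv.1 huv
    have a2 := strictMonoOn_quantile hQ hQ1 hu.1 hv.1 huv
    rcases ht.1.eq_or_lt with rfl | h0
    · simpa using a1
    · have := mul_lt_mul_of_pos_left a2 h0
      have := mul_le_mul_of_nonneg_left a1.le (sub_nonneg.2 ht.2)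
      linarith
  have := lintegral_image_eq_lintegral_abs_deriv_mul hSm
    (fun u hu => (((hgood u hu).1.2.2.const_mul (1 - t)).add
      ((hgood u hu).2.2.2.const_mul t)).hasDerivWithinAt) hinj G
  rw [← setLIntegral_congr hSae]
  refine le_trans ?_ (this.symm.le.trans (setLIntegral_le_lintegral _ _))
  refine setLIntegral_mono' hSm fun u hu => ?_
  rw [mul_comm]
  refine mul_le_mul_left ?_ _
  obtain ⟨⟨p0, p1, -⟩, ⟨q0, q1, -⟩⟩ := hgood u hu
  have hp := ENNReal.toReal_pos p0.ne' p1.ne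
  have hq := ENNReal.toReal_pos q0.ne' q1.ne
  rw [← ENNReal.ofReal_toReal p1.ne, ← ENNReal.ofReal_toReal q1.ne,
    ENNReal.ofReal_rpow_of_pos hp, ENNReal.ofReal_rpow_of_pos hq,
    ← ENNReal.ofReal_mul (by positivity), ← ENNReal.ofReal_inv_of_pos (by positivity),
    ENNReal.toReal_ofReal hp.le, ENNReal.toReal_ofReal hq.le]
  refine ENNReal.ofReal_le_ofReal (le_trans ?_ (le_abs_self _))
  rw [mul_inv, ← Real.inv_rpow hp.le, ← Real.inv_rpow hq.le]
  -- The derivative of the interpolation is (1-t)/P + t/Q, at least P^{-(1-t)} Q^{-t} by weighted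
  -- AM-GM.
  exact Real.geom_mean_le_arith_mean2_weighted (sub_nonneg.2 ht.2) ht.1 (by positivity)
    (by positivity) (by ring)

/-- Joint measurability lets a quantile depend on the coordinates already chosen in the triangular
coupling. The value 0 is used where the mass is not one. -/
lemma measurable_quantile_param {Ω : Type*} [MeasurableSpace Ω] {P : Ω → ℝ → ℝ≥0∞}
    (hP : Measurable (Function.uncurry P)) :
    ∃ x : Ω × ℝ → ℝ, Measurable x ∧ ∀ ω, ∫⁻ a, P ω a = 1 → ∀ u ∈ Ioo (0 : ℝ) 1,
      x (ω, u) = quantile (P ω) u := by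
  classical
  let A : Set (Ω × ℝ) := {z | ∫⁻ a, P z.1 a = 1 ∧ z.2 ∈ Ioo (0 : ℝ) 1}
  have hA : MeasurableSet A := by
    refine MeasurableSet.inter ?_ (measurable_snd measurableSet_Ioo)
    exact (hP.lintegral_prod_right'.comp measurable_fst) (measurableSet_singleton 1)
  refine ⟨A.piecewise (fun z => quantile (P z.1) z.2) 0, ?_, fun ω hω u hu => ?_⟩
  · refine measurable_of_Iic fun a => ?_
    have hF : Measurable fun ω => ∫⁻ x in Iic a, P ω x :=
      hP.lintegral_prod_right' (ν := volume.restrict (Iic a))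
    have : A.piecewise (fun z => quantile (P z.1) z.2) 0 ⁻¹' Iic a =
        A.ite {z | ENNReal.ofReal z.2 ≤ ∫⁻ x in Iic a, P z.1 x} ((0 : Ω × ℝ → ℝ) ⁻¹' Iic a) := by
      ext z
      by_cases hz : z ∈ A
      · have := quantile_le_iff (P := P z.1) (hP.comp measurable_prodMk_left) hz.1 hz.2 a
        simpa [Set.ite, hz, Function.comp_def] using this
      · simp [Set.ite, hz]
    rw [this]
    refine MeasurableSet.ite hA ?_ (measurable_const measurableSet_Iic)
    exact measurableSet_le (ENNReal.measurable_ofReal.comp measurable_snd) (hF.comp measurable_fst)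
  · exact piecewise_eq_of_mem _ _ _ ⟨hω, hu⟩

/-! ### The triangular coupling in dimension k. -/

/-- Triangular (Knothe) coupling of two families of probability densities on `ℝᵏ`: all
interpolations between the coupled variables have density at most any `m` which dominates
the corresponding weighted geometric means of the densities. -/
theorem exists_interpolation_coupling (k : ℕ) : ∀ {Ω : Type} [MeasurableSpace Ω]
    (p q : Ω → (Fin k → ℝ) → ℝ≥0∞), Measurable (Function.uncurry p) →
    Measurable (Function.uncurry q) →
    ∃ (U : Type) (_ : MeasurableSpace U) (ν : Measure U), IsProbabilityMeasure ν ∧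
      ∃ X Y : Ω × U → Fin k → ℝ, Measurable X ∧ Measurable Y ∧
        ∀ ω, ∫⁻ x, p ω x = 1 → ∫⁻ x, q ω x = 1 → ∀ t ∈ Icc (0 : ℝ) 1,
          ∀ m : (Fin k → ℝ) → ℝ≥0∞, Measurable m →
          (∀ x y, p ω x ^ (1 - t) * q ω y ^ t ≤ m ((1 - t) • x + t • y)) →
          ∀ g : (Fin k → ℝ) → ℝ≥0∞, Measurable g →
          ∫⁻ u, g ((1 - t) • X (ω, u) + t • Y (ω, u)) ∂ν ≤ ∫⁻ z, g z * m z := by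
  induction k with
  | zero =>
    -- In dimension 0 the space is one point and both densities equal 1 there, so m ≥ 1.
    intro Ω _ p q _ _
    refine ⟨Unit, inferInstance, Measure.dirac (), inferInstance, 0, 0, measurable_const,
      measurable_const, fun ω hp hq t ht m _ hm g _ => ?_⟩
    have hm := hm default default
    simp only [volume_pi, Measure.pi_of_empty _ default, lintegral_dirac] at hp hq ⊢
    simp only [hp, hq, ENNReal.one_rpow, mul_one] at hm
    rw [Subsingleton.elim ((1 - t) • (0 : Ω × Unit → Fin 0 → ℝ) (ω, ()) + t • (0 : Ω × Unit → Fin 0 → ℝ) (ω, ())) default]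
    rw [Subsingleton.elim ((1 - t) • (default : Fin 0 → ℝ) + _) default] at hm
    exact le_mul_of_one_le_right' hm
  | succ k ih =>
    intro Ω _ p q hp hq
    let e := (MeasurableEquiv.piFinSuccAbove (fun _ : Fin (k + 1) => ℝ) 0).symm
    have he : MeasurePreserving e := (volume_preserving_piFinSuccAbove (fun _ => ℝ) 0).symm
    have hlin : ∀ (t a b : ℝ) (x y : Fin k → ℝ), (1 - t) • e (a, x) + t • e (b, y) =
        e ((1 - t) * a + t * b, (1 - t) • x + t • y) := by
      intro t a b x y
      ext i
      refine Fin.cases ?_ (fun i => ?_) i <;>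
      simp [e, MeasurableEquiv.piFinSuccAbove, Fin.insertNthEquiv]
    have hint : ∀ g : (Fin (k + 1) → ℝ) → ℝ≥0∞, Measurable g →
        ∫⁻ a, ∫⁻ x, g (e (a, x)) = ∫⁻ z, g z := fun g hg => by
      rw [← he.lintegral_comp hg, Measure.volume_eq_prod]
      exact (lintegral_prod _ (hg.comp e.measurable).aemeasurable).symm
    have hmarg : ∀ r : Ω → (Fin (k + 1) → ℝ) → ℝ≥0∞, Measurable (Function.uncurry r) →
        Measurable (Function.uncurry fun ω a => ∫⁻ x, r ω (e (a, x))) := fun r hr => by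
      have : Measurable fun z : (Ω × ℝ) × (Fin k → ℝ) => r z.1.1 (e (z.1.2, z.2)) :=
        hr.comp (measurable_fst.fst.prodMk (e.measurable.comp (measurable_fst.snd.prodMk measurable_snd)))
      exact this.lintegral_prod_right'
    set P := fun (ω : Ω) (a : ℝ) => ∫⁻ x, p ω (e (a, x)) with hPdef
    set Q := fun (ω : Ω) (a : ℝ) => ∫⁻ x, q ω (e (a, x)) with hQdef
    have hP : Measurable (Function.uncurry P) := hmarg p hp
    have hQ : Measurable (Function.uncurry Q) := hmarg q hq
    obtain ⟨x₁, hx₁, hx₁'⟩ := measurable_quantile_param hP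
    obtain ⟨y₁, hy₁, hy₁'⟩ := measurable_quantile_param hQ
    have hcond : ∀ (r : Ω → (Fin (k + 1) → ℝ) → ℝ≥0∞) (x : Ω × ℝ → ℝ) (R : Ω → ℝ → ℝ≥0∞),
        Measurable (Function.uncurry r) → Measurable x → Measurable (Function.uncurry R) →
        Measurable (Function.uncurry fun (w : Ω × ℝ) (x' : Fin k → ℝ) =>
          r w.1 (e (x w, x')) * (R w.1 (x w))⁻¹) := fun r x R hr hx hR => by
      refine Measurable.mul ?_ (Measurable.inv ?_)
      · exact hr.comp (measurable_fst.fst.prodMk (e.measurable.comp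
          ((hx.comp measurable_fst).prodMk measurable_snd)))
      · exact hR.comp (measurable_fst.fst.prodMk (hx.comp measurable_fst))
    -- The first coordinates are quantiles of the first marginals at a common uniform level u. The
    -- induction hypothesis couples the conditional densities of the other coordinates, with u added
    -- to the parameter space; this is why Ω is quantified inside the induction.
    obtain ⟨U, _, ν, hν, X, Y, hX, hY, h⟩ := ih
      (fun (w : Ω × ℝ) x' => p w.1 (e (x₁ w, x')) * (P w.1 (x₁ w))⁻¹)
      (fun (w : Ω × ℝ) x' => q w.1 (e (y₁ w, x')) * (Q w.1 (y₁ w))⁻¹)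
      (hcond p x₁ P hp hx₁ hP) (hcond q y₁ Q hq hy₁ hQ)
    have : IsProbabilityMeasure (volume.restrict (Ioo (0 : ℝ) 1)) := ⟨by simp⟩
    have hlift : ∀ (x : Ω × ℝ → ℝ) (X : (Ω × ℝ) × U → Fin k → ℝ), Measurable x → Measurable X →
        Measurable fun z : Ω × ℝ × U => e (x (z.1, z.2.1), X ((z.1, z.2.1), z.2.2)) :=
      fun x X hx hX => e.measurable.comp ((hx.comp (measurable_fst.prodMk measurable_snd.fst)).prodMk
        (hX.comp ((measurable_fst.prodMk measurable_snd.fst).prodMk measurable_snd.snd)))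
    refine ⟨ℝ × U, inferInstance, (volume.restrict (Ioo (0 : ℝ) 1)).prod ν, inferInstance,
      fun z => e (x₁ (z.1, z.2.1), X ((z.1, z.2.1), z.2.2)),
      fun z => e (y₁ (z.1, z.2.1), Y ((z.1, z.2.1), z.2.2)), hlift _ _ hx₁ hX, hlift _ _ hy₁ hY,
      fun ω hp1 hq1 t ht m hm hpq g hg => ?_⟩
    have hP1 : ∫⁻ a, P ω a = 1 := by
      rw [← hp1, ← hint (p ω) (hp.comp measurable_prodMk_left)]
    have hQ1 : ∫⁻ a, Q ω a = 1 := by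
      rw [← hq1, ← hint (q ω) (hq.comp measurable_prodMk_left)]
    have hPω : Measurable (P ω) := hP.comp measurable_prodMk_left
    have hQω : Measurable (Q ω) := hQ.comp measurable_prodMk_left
    simp only [hlin]
    rw [lintegral_prod _ ?_]
    swap
    · refine (hg.comp (e.measurable.comp (Measurable.prodMk ?_ ?_))).aemeasurable
      · exact ((hx₁.comp (measurable_const.prodMk measurable_fst)).const_mul _).add
          ((hy₁.comp (measurable_const.prodMk measurable_fst)).const_mul _)
      · have hmk : Measurable fun z : ℝ × U => ((ω, z.1), z.2) :=
          (measurable_const.prodMk measurable_fst).prodMk measurable_snd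
        exact ((hX.comp hmk).const_smul (1 - t)).add ((hY.comp hmk).const_smul t)
    set G : ℝ → ℝ≥0∞ := fun a => ∫⁻ z', g (e (a, z')) * m (e (a, z')) with hG
    rw [← hint (fun z => g z * m z) (hg.mul hm)]
    refine le_trans (lintegral_mono_ae ?_)
      (lintegral_quantile_interpolation_le hPω hP1 hQω hQ1 ht G)
    filter_upwards [ae_hasDerivAt_quantile hPω hP1, ae_hasDerivAt_quantile hQω hQ1,
      ae_restrict_mem measurableSet_Ioo] with u ⟨p0, p1, _⟩ ⟨q0, q1, _⟩ hu
    rw [← hx₁' ω hP1 u hu] at p0 p1 ⊢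
    rw [← hy₁' ω hQ1 u hu] at q0 q1 ⊢
    set a := x₁ (ω, u)
    set b := y₁ (ω, u)
    have hem : ∀ c, Measurable fun x : Fin k → ℝ => e (c, x) := fun c =>
      e.measurable.comp measurable_prodMk_left
    have hnorm : ∀ (r : (Fin (k + 1) → ℝ) → ℝ≥0∞) (c : ℝ), Measurable r →
        0 < ∫⁻ x, r (e (c, x)) → ∫⁻ x, r (e (c, x)) < ∞ →
        ∫⁻ x', r (e (c, x')) * (∫⁻ x, r (e (c, x)))⁻¹ = 1 := fun r c hr h0 h1 => by
      have hrc : Measurable fun x' => r (e (c, x')) := hr.comp (hem c)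
      rw [lintegral_mul_const _ hrc, ENNReal.mul_inv_cancel h0.ne' h1.ne]
    have t0 : 0 ≤ 1 - t := sub_nonneg.2 ht.2
    have key := h (ω, u) (hnorm (p ω) a (hp.comp measurable_prodMk_left) p0 p1)
      (hnorm (q ω) b (hq.comp measurable_prodMk_left) q0 q1) t ht
      -- Conditioning divides p and q by their marginals. The factor this leaves on m is exactly the
      -- weight in `lintegral_quantile_interpolation_le`.
      (fun z' => m (e ((1 - t) * a + t * b, z')) * (P ω a ^ (1 - t) * Q ω b ^ t)⁻¹)
      ((hm.comp (hem _)).mul_const _) (fun x y => ?_)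
      (fun z' => g (e ((1 - t) * a + t * b, z'))) (hg.comp (hem _))
    · refine key.trans (le_of_eq ?_)
      simp only [← mul_assoc]
      exact lintegral_mul_const _ ((hg.comp (hem _)).mul (hm.comp (hem _)))
    · have hm' := hpq (e (a, x)) (e (b, y))
      rw [hlin] at hm'
      have hPt : (P ω a ^ (1 - t)) ≠ 0 := (ENNReal.rpow_pos p0 p1.ne).ne'
      have hPt' : (P ω a ^ (1 - t)) ≠ ∞ := ENNReal.rpow_ne_top_of_nonneg t0 p1.ne
      rw [ENNReal.mul_rpow_of_nonneg _ _ t0, ENNReal.mul_rpow_of_nonneg _ _ ht.1,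
        ENNReal.inv_rpow, ENNReal.inv_rpow, ENNReal.mul_inv (.inl hPt) (.inl hPt'),
        mul_mul_mul_comm]
      exact mul_le_mul_left hm' _

/-! ### The dilation inequality. -/

/-- Testing with the indicator of {r = 0} suffices. Applied to the coupling at t = 0 and t = 1, it
places X where p ≠ 0 and Y where q ≠ 0. -/
lemma ae_density_ne_zero {α U : Type*} [MeasurableSpace α] [MeasurableSpace U] {μ : Measure α}
    {ν : Measure U} {X : U → α} (hX : Measurable X) {r : α → ℝ≥0∞} (hr : Measurable r)
    (h : ∀ g : α → ℝ≥0∞, Measurable g → ∫⁻ u, g (X u) ∂ν ≤ ∫⁻ z, g z * r z ∂μ) :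
    ∀ᵐ u ∂ν, r (X u) ≠ 0 := by
  have hS : MeasurableSet {x | r x = 0} := hr (measurableSet_singleton 0)
  have hm : Measurable ({x | r x = 0}.indicator (1 : α → ℝ≥0∞)) := measurable_one.indicator hS
  have h0 : ∫⁻ z, {x | r x = 0}.indicator 1 z * r z ∂μ = 0 := by
    rw [← lintegral_zero]
    refine lintegral_congr fun z => ?_
    by_cases hz : r z = 0 <;> simp [hz]
  have := h _ hm
  have hmX : Measurable fun u => {x | r x = 0}.indicator (1 : α → ℝ≥0∞) (X u) := hm.comp hX
  rw [h0, nonpos_iff_eq_zero, lintegral_eq_zero_iff hmX] at this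
  filter_upwards [this] with u hu hu'
  simp [hu'] at hu

/-- A dimension-free dilation inequality for log-concave probability densities: if every segment
from the support to a point of `D` meets `B` in a small proportion, then `B` has small measure. -/
theorem logConcave_dilation {k : ℕ} {p : (Fin k → ℝ) → ℝ≥0∞} (hp : Measurable p)
    (hp1 : ∫⁻ x, p x = 1)
    (hlc : ∀ x y, ∀ t ∈ Icc (0 : ℝ) 1, p x ^ (1 - t) * p y ^ t ≤ p ((1 - t) • x + t • y))
    {D B : Set (Fin k → ℝ)} (hD : MeasurableSet D) (hB : MeasurableSet B)
    (hD0 : volume.withDensity p D ≠ 0) {η : ℝ≥0∞}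
    (hη : ∀ x y, p x ≠ 0 → p y ≠ 0 → y ∈ D →
      volume {t : ℝ | t ∈ Icc (0 : ℝ) 1 ∧ (1 - t) • x + t • y ∈ B} ≤ η)
    {ε : ℝ} (hε : ε ∈ Icc (0 : ℝ) 1) :
    ENNReal.ofReal ε * (1 - (volume.withDensity p D)⁻¹ ^ ε * volume.withDensity p Bᶜ) ≤ η := by
  set δ := volume.withDensity p D with hδ
  have hprob : IsProbabilityMeasure (volume.withDensity p) := ⟨by simpa using hp1⟩
  have hδ1 : δ ≤ 1 := prob_le_one
  have hδt : δ ≠ ∞ := ne_top_of_le_ne_top ENNReal.one_ne_top hδ1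
  set q : (Fin k → ℝ) → ℝ≥0∞ := fun x => δ⁻¹ * D.indicator p x with hq
  have hqm : Measurable q := (hp.indicator hD).const_mul _
  have hq1 : ∫⁻ x, q x = 1 := by
    rw [hq, lintegral_const_mul _ (hp.indicator hD), lintegral_indicator hD,
      ← withDensity_apply _ hD, ENNReal.inv_mul_cancel hD0 hδt]
  obtain ⟨U, _, ν, hν, X, Y, hX, hY, h⟩ := exists_interpolation_coupling k
    (fun _ : Unit => p) (fun _ : Unit => q) (hp.comp measurable_snd) (hqm.comp measurable_snd)
  replace h := h () hp1 hq1
  replace hX : Measurable fun u => X ((), u) := hX.comp measurable_prodMk_left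
  replace hY : Measurable fun u => Y ((), u) := hY.comp measurable_prodMk_left
  have hXp : ∀ᵐ u ∂ν, p (X ((), u)) ≠ 0 := by
    refine ae_density_ne_zero (μ := volume) hX hp fun g hg => ?_
    simpa using h 0 (by simp) p hp (by simp) g hg
  have hYq : ∀ᵐ u ∂ν, q (Y ((), u)) ≠ 0 := by
    refine ae_density_ne_zero (μ := volume) hY hqm fun g hg => ?_
    simpa using h 1 (by simp) q hqm (by simp) g hg
  let Z : ℝ → U → Fin k → ℝ := fun t u => (1 - t) • X ((), u) + t • Y ((), u)
  have hZ : Measurable fun z : ℝ × U => Z z.1 z.2 :=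
    ((measurable_const.sub measurable_fst).smul (hX.comp measurable_snd)).add
      (measurable_fst.smul (hY.comp measurable_snd))
  have hZt : ∀ t, Measurable (Z t) := fun t => hZ.comp measurable_prodMk_left
  -- Since q ≤ δ⁻¹ p and p is log-concave, m = δ^{-t} p is admissible in the coupling. It bounds the
  -- probability that Z t leaves B, and δ^{-t} ≤ δ^{-ε} as δ ≤ 1.
  have hlow : ∀ t ∈ Icc (0 : ℝ) ε, 1 - δ⁻¹ ^ ε * volume.withDensity p Bᶜ ≤ ν (Z t ⁻¹' B) := by
    intro t ht
    have ht1 : t ∈ Icc (0 : ℝ) 1 := ⟨ht.1, ht.2.trans hε.2⟩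
    have h1 := h t ht1 (fun z => δ⁻¹ ^ t * p z) (hp.const_mul _) (fun x y => ?_)
      (Bᶜ.indicator 1) (measurable_one.indicator hB.compl)
    · have e1 : ∫⁻ u, Bᶜ.indicator (1 : (Fin k → ℝ) → ℝ≥0∞) (Z t u) ∂ν = ν (Z t ⁻¹' B)ᶜ := by
        rw [← lintegral_indicator_one ((hZt t hB).compl)]
        rfl
      have e2 : ∫⁻ z, Bᶜ.indicator 1 z * (δ⁻¹ ^ t * p z) =
          δ⁻¹ ^ t * volume.withDensity p Bᶜ := by
        rw [withDensity_apply _ hB.compl, ← lintegral_indicator hB.compl,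
          ← lintegral_const_mul _ (hp.indicator hB.compl)]
        refine lintegral_congr fun z => ?_
        by_cases hz : z ∈ Bᶜ <;> simp [hz]
      have h1' := (e1.symm.le.trans h1).trans e2.le
      have hmono : δ⁻¹ ^ t ≤ δ⁻¹ ^ ε :=
        ENNReal.rpow_le_rpow_of_exponent_le (ENNReal.one_le_inv.2 hδ1) ht.2
      rw [tsub_le_iff_right, ← measure_univ (μ := ν), ← measure_add_measure_compl (hZt t hB)]
      gcongr
      exact h1'.trans (mul_le_mul_left hmono _)
    · refine le_trans ?_ (mul_le_mul_right (hlc x y t ht1) _)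
      have : q y ^ t ≤ δ⁻¹ ^ t * p y ^ t := by
        rw [← ENNReal.mul_rpow_of_nonneg _ _ ht.1]
        refine ENNReal.rpow_le_rpow (mul_le_mul_right ?_ _) ht.1
        exact indicator_le_self _ _ _
      calc p x ^ (1 - t) * q y ^ t ≤ p x ^ (1 - t) * (δ⁻¹ ^ t * p y ^ t) := by gcongr
        _ = _ := by ring
  -- By Tonelli this is the mean time in [0, ε] that the random segment from X to Y spends in B, and
  -- almost surely Y lies in D.
  have hup : ∫⁻ t in Icc 0 ε, ν (Z t ⁻¹' B) ≤ η := by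
    have hA : MeasurableSet {z : ℝ × U | Z z.1 z.2 ∈ B} := hZ hB
    have e := Measure.prod_apply (μ := volume.restrict (Icc 0 ε)) (ν := ν) hA
    rw [Measure.prod_apply_symm hA] at e
    refine e.symm.le.trans ?_
    have : η = ∫⁻ _u, η ∂ν := by simp
    rw [this]
    refine lintegral_mono_ae ?_
    filter_upwards [hXp, hYq] with u hu hv
    have hv' : p (Y ((), u)) ≠ 0 ∧ Y ((), u) ∈ D := by
      by_contra hcon
      apply hv
      by_cases hyD : Y ((), u) ∈ D
      · have : p (Y ((), u)) = 0 := by tauto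
        simp [hq, hyD, this]
      · simp [hq, hyD]
    refine le_trans ?_ (hη _ _ hu hv'.1 hv'.2)
    rw [Measure.restrict_apply' measurableSet_Icc]
    exact measure_mono fun t ht => ⟨⟨ht.2.1, ht.2.2.trans hε.2⟩, ht.1⟩
  refine le_trans ?_ hup
  refine le_trans ?_ (setLIntegral_mono' measurableSet_Icc hlow)
  simp [mul_comm]

/-! ### Exponential tails around the median. -/

/-- A measurable real function on a probability space has a median. -/
lemma exists_median {α : Type*} [MeasurableSpace α] {μ : Measure α} [IsProbabilityMeasure μ]
    {φ : α → ℝ} (hφ : Measurable φ) :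
    ∃ β : ℝ, 1 / 2 ≤ μ.real {x | φ x ≤ β} ∧ 1 / 2 ≤ μ.real {x | β ≤ φ x} := by
  have := Measure.isProbabilityMeasure_map (μ := μ) hφ.aemeasurable
  set F := ProbabilityTheory.cdf (μ.map φ) with hFdef
  have hF : ∀ a, F a = μ.real {x | φ x ≤ a} := fun a => by
    rw [hFdef, ProbabilityTheory.cdf_eq_real, map_measureReal_apply hφ measurableSet_Iic]; rfl
  have hbot := ProbabilityTheory.tendsto_cdf_atBot (μ.map φ)
  have htop := ProbabilityTheory.tendsto_cdf_atTop (μ.map φ)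
  have hbd : BddBelow {a | 1 / 2 ≤ F a} := by
    obtain ⟨b, hb⟩ := ((tendsto_order.1 hbot).2 (1 / 2) (by norm_num)).exists
    exact ⟨b, fun a ha => le_of_lt (lt_of_not_ge fun hab => (ha.trans (F.mono hab)).not_gt hb)⟩
  have hne : {a | 1 / 2 ≤ F a}.Nonempty :=
    ((tendsto_order.1 htop).1 (1 / 2) (by norm_num)).exists.imp fun _ h => h.le
  refine ⟨sInf {a | 1 / 2 ≤ F a}, ?_, ?_⟩
  · rw [← hF]
    refine ge_of_tendsto ((F.right_continuous' (sInf {a | 1 / 2 ≤ F a})).mono Ioi_subset_Ici_self) ?_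
    filter_upwards [self_mem_nhdsWithin] with b hb
    obtain ⟨a, ha, hab⟩ := (csInf_lt_iff hbd hne).1 hb
    exact le_trans ha (F.mono hab.le)
  · set β := sInf {a | 1 / 2 ≤ F a}
    have hlt : ∀ b < β, 1 / 2 ≤ μ.real {x | b < φ x} := fun b hb => by
      have h1 : F b < 1 / 2 := lt_of_not_ge fun h => hb.not_ge (csInf_le hbd h)
      have h2 : μ.real {x | φ x ≤ b}ᶜ = 1 - F b := by
        rw [probReal_compl_eq_one_sub (measurableSet_le hφ measurable_const), hF]
      have h3 : {x | φ x ≤ b}ᶜ = {x | b < φ x} := by ext; simp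
      rw [← h3, h2]; linarith
    have hset : {x | β ≤ φ x} = ⋂ n : ℕ, {x | β - 1 / (n + 1) < φ x} := by
      ext x
      simp only [mem_ofPred_eq, mem_iInter]
      refine ⟨fun h n => lt_of_lt_of_le (by simp; positivity) h, fun h => le_of_forall_pos_lt_add fun e he => ?_⟩
      obtain ⟨n, hn⟩ := exists_nat_one_div_lt he
      linarith [h n]
    have ht := tendsto_measure_iInter_atTop (μ := μ) (s := fun n : ℕ => {x | β - 1 / (n + 1) < φ x})
      (fun n => (measurableSet_lt measurable_const hφ).nullMeasurableSet)
      (fun m n hmn x hx => lt_of_le_of_lt (sub_le_sub_left (Nat.one_div_le_one_div hmn) β) hx) ⟨0, measure_ne_top _ _⟩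
    rw [← hset] at ht
    have ht' := (ENNReal.tendsto_toReal (measure_ne_top _ _)).comp ht
    exact ge_of_tendsto' ht' fun n => hlt _ (by simp; positivity)

lemma logConcave_dilation_real {k : ℕ} {p : (Fin k → ℝ) → ℝ≥0∞} (hp : Measurable p)
    (hp1 : ∫⁻ x, p x = 1)
    (hlc : ∀ x y, ∀ t ∈ Icc (0 : ℝ) 1, p x ^ (1 - t) * p y ^ t ≤ p ((1 - t) • x + t • y))
    {D B : Set (Fin k → ℝ)} (hD : MeasurableSet D) (hB : MeasurableSet B)
    (hD0 : 0 < (volume.withDensity p).real D) {η : ℝ} (hη0 : 0 ≤ η)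
    (hη : ∀ x y, p x ≠ 0 → p y ≠ 0 → y ∈ D →
      volume {t : ℝ | t ∈ Icc (0 : ℝ) 1 ∧ (1 - t) • x + t • y ∈ B} ≤ ENNReal.ofReal η)
    {ε : ℝ} (hε : ε ∈ Icc (0 : ℝ) 1) :
    ε * (1 - ((volume.withDensity p).real D)⁻¹ ^ ε * (1 - (volume.withDensity p).real B)) ≤ η := by
  have : IsProbabilityMeasure (volume.withDensity p) := ⟨by simpa using hp1⟩
  have h := logConcave_dilation hp hp1 hlc hD hB
    (fun h => hD0.ne' (by simp [measureReal_def, h])) hη hε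
  rw [← ofReal_measureReal (s := D), ← ofReal_measureReal (s := Bᶜ), ← ENNReal.ofReal_inv_of_pos hD0,
    ENNReal.ofReal_rpow_of_pos (inv_pos.2 hD0), ← ENNReal.ofReal_mul (by positivity),
    ← ENNReal.ofReal_one, ← ENNReal.ofReal_sub _ (by positivity), ← ENNReal.ofReal_mul hε.1,
    ENNReal.ofReal_le_ofReal_iff hη0, probReal_compl_eq_one_sub hB] at h
  exact h

/-- If a nonnegative function satisfies a Remez-type inequality with exponent `d` on segments, the
mean oscillation of its logarithm under a log-concave probability is at most a universal
multiple of `d`. -/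
theorem logConcave_mean_oscillation {k : ℕ} {p : (Fin k → ℝ) → ℝ≥0∞} (hp : Measurable p)
    (hp1 : ∫⁻ x, p x = 1)
    (hlc : ∀ x y, ∀ t ∈ Icc (0 : ℝ) 1, p x ^ (1 - t) * p y ^ t ≤ p ((1 - t) • x + t • y))
    {φ : (Fin k → ℝ) → ℝ} (hφ : Measurable φ) (hφ0 : ∀ x, 0 ≤ φ x)
    (hφ1 : ∀ᵐ x ∂(volume.withDensity p), φ x ≠ 0) {d : ℝ} (hd : 0 < d)
    (hR : ∀ x y, p x ≠ 0 → p y ≠ 0 → ∀ α, 0 < α → ∀ s : ℝ, α * Real.exp (d * s) ≤ φ y →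
      volume {t : ℝ | t ∈ Icc (0 : ℝ) 1 ∧ φ ((1 - t) • x + t • y) ≤ α} ≤
        ENNReal.ofReal (4 * Real.exp (-s))) :
    ∃ M : ℝ, ∫⁻ x, ENNReal.ofReal |Real.log (φ x) - M| ∂(volume.withDensity p) ≤
      ENNReal.ofReal (72 * d) := by
  have hprob : IsProbabilityMeasure (volume.withDensity p) := ⟨by simpa using hp1⟩
  set μ := volume.withDensity p with hμ
  obtain ⟨β, hβ1, hβ2⟩ := exists_median (μ := μ) hφ
  have hβ : 0 < β := by
    by_contra! hβ
    have : μ {x | φ x ≤ β} = 0 :=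
      measure_mono_null (t := {x | ¬φ x ≠ 0})
        (fun x hx h => h (le_antisymm (le_trans hx hβ) (hφ0 x))) (ae_iff.1 hφ1)
    rw [measureReal_def, this] at hβ1
    norm_num at hβ1
  have hle : ∀ a, MeasurableSet {x | φ x ≤ a} := fun a => measurableSet_le hφ measurable_const
  have hge : ∀ a, MeasurableSet {x | a ≤ φ x} := fun a => measurableSet_le measurable_const hφ
  have hupper : ∀ s, 0 ≤ s → μ.real {x | β * Real.exp (d * s) ≤ φ x} ≤ 32 * Real.exp (-s) := by
    intro s hs
    set δ := μ.real {x | β * Real.exp (d * s) ≤ φ x} with hδ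
    have hδ1 : δ ≤ 1 := measureReal_le_one
    -- This makes η = ε/4. With μ(B) ≥ 1/2, dilation gives δ^{-ε} ≥ 3/2, and Bernoulli's inequality
    -- then gives δ⁻¹ ≥ 1/(2ε). For ε > 1 the claim is trivial.
    set ε := 16 * Real.exp (-s) with hεdef
    have hε0 : 0 < ε := by positivity
    rcases lt_or_ge 1 ε with hε | hε
    · linarith
    rcases measureReal_nonneg.eq_or_lt' (a := δ) with h0 | hδ0
    · rw [h0]; positivity
    have := logConcave_dilation_real hp hp1 hlc (hge (β * Real.exp (d * s))) (hle β) hδ0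
      (η := 4 * Real.exp (-s)) (by positivity) (fun x y hx hy hyD => hR x y hx hy β hβ s hyD)
      ⟨hε0.le, hε⟩
    rw [← hμ, ← hδ] at this
    have h1 : 1 - δ⁻¹ ^ ε * (1 - μ.real {x | φ x ≤ β}) ≤ 1 / 4 := by
      have : ε * (1 - δ⁻¹ ^ ε * (1 - μ.real {x | φ x ≤ β})) ≤ ε * (1 / 4) := by linarith
      exact le_of_mul_le_mul_left this hε0
    have h2 : 0 ≤ δ⁻¹ ^ ε := by positivity
    have h3 : 1 + 1 / 2 ≤ δ⁻¹ ^ ε := by nlinarith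
    have h4 : (1 + 1 / 2 : ℝ) ^ ε⁻¹ ≤ δ⁻¹ := by
      refine (Real.rpow_le_rpow (by norm_num) h3 (by positivity)).trans ?_
      rw [← Real.rpow_mul (by positivity), mul_inv_cancel₀ hε0.ne', Real.rpow_one]
    have h5 := one_add_mul_self_le_rpow_one_add (s := 1 / 2) (by norm_num)
      ((one_le_inv₀ hε0).2 hε)
    have h6 : (2 * ε)⁻¹ ≤ δ⁻¹ := by
      rw [mul_inv]; linarith
    rw [inv_le_inv₀ (by positivity) hδ0] at h6
    linarith
  have hlower : ∀ s, 0 ≤ s → μ.real {x | φ x ≤ β * Real.exp (-(d * s))} ≤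
      4 * Real.exp (-s / 2) := by
    intro s hs
    set b := μ.real {x | φ x ≤ β * Real.exp (-(d * s))} with hb
    have hb1 : b ≤ 1 := measureReal_le_one
    -- Now η = ε² balances the two errors: δ ≥ 1/2 gives δ^{-ε} ≤ 2^ε ≤ 1 + ε, so 1 - ε ≤ (1 + ε)(1
    -- - b), whence b ≤ 2ε.
    set ε := 2 * Real.exp (-s / 2) with hεdef
    have hε0 : 0 < ε := by positivity
    rcases lt_or_ge 1 ε with hε | hε
    · linarith
    set δ := μ.real {x | β ≤ φ x} with hδ
    have hδ0 : 0 < δ := by linarith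
    have hε2 : 4 * Real.exp (-s) = ε * ε := by
      rw [hεdef, show -s = -s / 2 + -s / 2 by ring, Real.exp_add]; ring_nf
    have := logConcave_dilation_real hp hp1 hlc (hge β) (hle (β * Real.exp (-(d * s)))) hδ0
      (η := 4 * Real.exp (-s)) (by positivity)
      (fun x y hx hy hyD => hR x y hx hy _ (by positivity) s ?_) ⟨hε0.le, hε⟩
    · rw [← hμ, ← hδ, ← hb, hε2] at this
      have h1 := le_of_mul_le_mul_left this hε0
      have h2 : δ⁻¹ ^ ε ≤ 1 + ε := by
        have e1 : δ⁻¹ ≤ 1 + 1 := by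
          rw [inv_le_comm₀ hδ0 (by norm_num)]; linarith
        refine (Real.rpow_le_rpow (by positivity) e1 hε0.le).trans ?_
        simpa using rpow_one_add_le_one_add_mul_self (s := 1) (by norm_num) hε0.le hε
      have h3 : δ⁻¹ ^ ε * (1 - b) ≤ (1 + ε) * (1 - b) := by
        gcongr
      have h4 : 1 - ε ≤ (1 + ε) * (1 - b) := by linarith
      nlinarith
    · rw [mul_assoc, ← Real.exp_add]
      simpa using hyD
  have htail : ∀ s, 0 ≤ s → μ.real {x | d * s ≤ |Real.log (φ x) - Real.log β|} ≤
      36 * Real.exp (-s / 2) := by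
    intro s hs
    have hsub : {x | d * s ≤ |Real.log (φ x) - Real.log β|} ⊆
        {x | β * Real.exp (d * s) ≤ φ x} ∪ {x | φ x ≤ β * Real.exp (-(d * s))} := by
      intro x hx
      rcases (hφ0 x).eq_or_lt with h0 | hpos
      · right
        change φ x ≤ _
        rw [← h0]; positivity
      · rcases le_abs.1 (show d * s ≤ |Real.log (φ x) - Real.log β| from hx) with h | h
        · left
          change _ ≤ φ x
          rw [← Real.exp_log hpos, ← Real.exp_log hβ, ← Real.exp_add, Real.exp_le_exp]
          linarith
        · right
          change φ x ≤ _
          rw [← Real.exp_log hpos, ← Real.exp_log hβ, ← Real.exp_add, Real.exp_le_exp]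
          linarith
    refine (measureReal_mono hsub).trans ((measureReal_union_le _ _).trans ?_)
    have : Real.exp (-s) ≤ Real.exp (-s / 2) := Real.exp_le_exp.2 (by linarith)
    linarith [hupper s hs, hlower s hs]
  refine ⟨Real.log β, ?_⟩
  have hmeas : Measurable fun x => |Real.log (φ x) - Real.log β| :=
    ((Real.measurable_log.comp hφ).sub_const _).abs
  rw [lintegral_eq_lintegral_meas_le μ (Filter.Eventually.of_forall fun x => abs_nonneg _)
    hmeas.aemeasurable]
  have hneg : -(2 * d)⁻¹ < 0 := by simp [hd]
  -- The tail at height t = ds is at most 36 e^{-t/(2d)}; the layer cake formula integrates it to 36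
  -- · 2d.
  have hval : 72 * d = ∫ t in Ioi (0 : ℝ), 36 * Real.exp (-(2 * d)⁻¹ * t) := by
    rw [integral_const_mul, integral_exp_mul_Ioi hneg]
    field_simp
    norm_num
  rw [hval, ofReal_integral_eq_lintegral_ofReal
    ((integrableOn_exp_mul_Ioi hneg 0).const_mul 36)
    (Filter.Eventually.of_forall fun t => by positivity)]
  refine setLIntegral_mono' measurableSet_Ioi fun t ht => ?_
  rw [← ofReal_measureReal]
  refine ENNReal.ofReal_le_ofReal ?_
  have := htail (t / d) (div_nonneg (le_of_lt ht) hd.le)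
  rw [mul_div_cancel₀ _ hd.ne'] at this
  refine this.trans (le_of_eq ?_)
  congr 2
  field_simp

/-! ### Sublevel sets of functions with a large derivative. -/

/-- A set of reals of large measure contains `N + 1` points with gaps at least `η`. -/
lemma exists_separated_of_lt_volume {η : ℝ} (hη : 0 < η) (N : ℕ) : ∀ E : Set ℝ, BddBelow E →
    ENNReal.ofReal (2 * N * η) < volume E →
    ∃ x : ℕ → ℝ, (∀ i ≤ N, x i ∈ E) ∧ ∀ i < N, x i + η ≤ x (i + 1) := by
  induction N with
  | zero =>
    intro E _ h
    obtain ⟨a, ha⟩ := nonempty_of_measure_ne_zero (pos_of_gt h).ne'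
    exact ⟨fun _ => a, fun _ _ => ha, fun i hi => absurd hi (by simp)⟩
  | succ N ih =>
    intro E hE h
    have hne := nonempty_of_measure_ne_zero (pos_of_gt h).ne'
    -- The infimum need not belong to E. A point within η of it costs at most 2η of measure, hence
    -- the factor 2 in the hypothesis.
    obtain ⟨a, ha, haE⟩ := exists_lt_of_csInf_lt hne (lt_add_of_pos_right (sInf E) hη)
    have hsub : E ⊆ Ico (sInf E) (sInf E + 2 * η) ∪ (E ∩ Ici (a + η)) := by
      intro b hb
      rcases lt_or_ge b (a + η) with h1 | h1
      · exact .inl ⟨csInf_le hE hb, by linarith⟩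
      · exact .inr ⟨hb, h1⟩
    have hvol : ENNReal.ofReal (2 * N * η) < volume (E ∩ Ici (a + η)) := by
      by_contra! hcon
      refine h.not_ge ((measure_mono hsub).trans ((measure_union_le _ _).trans ?_))
      rw [Real.volume_Ico, add_sub_cancel_left]
      refine (add_le_add_right hcon _).trans ?_
      rw [← ENNReal.ofReal_add (by positivity) (by positivity)]
      refine ENNReal.ofReal_le_ofReal (le_of_eq ?_)
      push_cast; ring
    obtain ⟨x, hx, hx'⟩ := ih _ (hE.mono inter_subset_left) hvol
    refine ⟨fun i => Nat.casesOn i a x, fun i hi => ?_, fun i hi => ?_⟩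
    · cases i with
      | zero => exact ha
      | succ i => exact (hx i (by omega)).1
    · cases i with
      | zero => exact (hx 0 (by omega)).2
      | succ i => exact hx' i (by omega)

/-- Iterated mean value theorem: a function which is small at `2 ^ n` separated points has a small
`n`-th derivative somewhere. -/
lemma exists_abs_deriv_le_of_separated {J : Set ℝ} (hJ : J.OrdConnected) {η : ℝ} (hη : 0 < η)
    (n : ℕ) : ∀ (f : ℕ → ℝ → ℝ) (ε : ℝ),
    (∀ i, ∀ t ∈ J, HasDerivAt (f i) (f (i + 1) t) t) →
    ∀ x : ℕ → ℝ, (∀ i < 2 ^ n, x i ∈ J ∧ |f 0 (x i)| ≤ ε) →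
    (∀ i, i + 1 < 2 ^ n → x i + η ≤ x (i + 1)) →
    ∃ ξ ∈ J, |f n ξ| ≤ ε * (2 / η) ^ n := by
  induction n with
  | zero =>
    intro f ε _ x hx _
    exact ⟨x 0, (hx 0 (by simp)).1, by simpa using (hx 0 (by simp)).2⟩
  | succ n ih =>
    intro f ε hf x hx hsep
    -- Disjoint pairs of points are used, so their number halves. The gap between consecutive pairs
    -- keeps the new points η-separated.
    have hmvt : ∀ i, i < 2 ^ n → ∃ y, y ∈ Ioo (x (2 * i)) (x (2 * i + 1)) ∧
        |f 1 y| ≤ ε * (2 / η) := by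
      intro i hi
      have hp : 2 * i + 1 < 2 ^ (n + 1) := by rw [pow_succ]; omega
      have hgap := hsep (2 * i) hp
      have hIcc : Icc (x (2 * i)) (x (2 * i + 1)) ⊆ J :=
        hJ.out (hx _ (by omega)).1 (hx _ hp).1
      obtain ⟨y, hy, hy'⟩ := exists_hasDerivAt_eq_slope (f 0) (f 1)
        (show x (2 * i) < x (2 * i + 1) by linarith)
        (fun t ht => (hf 0 t (hIcc ht)).continuousAt.continuousWithinAt)
        (fun t ht => hf 0 t (hIcc (Ioo_subset_Icc_self ht)))
      refine ⟨y, hy, ?_⟩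
      have h1 := (hx (2 * i) (by omega)).2
      have h2 := (hx (2 * i + 1) hp).2
      have hε : 0 ≤ ε := (abs_nonneg _).trans h1
      rw [hy', abs_div, abs_of_pos (show 0 < x (2 * i + 1) - x (2 * i) by linarith)]
      calc |f 0 (x (2 * i + 1)) - f 0 (x (2 * i))| / (x (2 * i + 1) - x (2 * i))
          ≤ (ε + ε) / η := by
            refine div_le_div₀ (by linarith) ((abs_sub _ _).trans (add_le_add h2 h1)) hη
              (by linarith)
        _ = ε * (2 / η) := by ring
    choose! y hy hy' using hmvt
    have hmem : ∀ i < 2 ^ n, y i ∈ J := fun i hi => by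
      have hp : 2 * i + 1 < 2 ^ (n + 1) := by rw [pow_succ]; omega
      exact hJ.out (hx _ (by omega)).1 (hx _ hp).1 (Ioo_subset_Icc_self (hy i hi))
    obtain ⟨ξ, hξ, h⟩ := ih (fun i => f (i + 1)) (ε * (2 / η)) (fun i t ht => hf (i + 1) t ht) y
      (fun i hi => ⟨hmem i hi, hy' i hi⟩) (fun i hi => by
        have h1 := (hy i (by omega)).2
        have h2 := (hy (i + 1) hi).1
        have h3 := hsep (2 * i + 1) (by rw [pow_succ]; omega)
        rw [show 2 * (i + 1) = 2 * i + 1 + 1 by ring] at h2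
        linarith)
    exact ⟨ξ, hξ, h.trans (le_of_eq (by rw [pow_succ]; ring))⟩

/-- Sublevel set estimate: if the `n`-th derivative is at least `c` in absolute value, then the
set where the function is at most `ε` has measure at most `A * ε ^ τ`. -/
lemma exists_volume_sublevel_le (n : ℕ) {c : ℝ} (hc : 0 < c) :
    ∃ A τ : ℝ, 0 ≤ A ∧ 0 < τ ∧ ∀ δ ∈ Ioc (0 : ℝ) 1, ∀ f : ℕ → ℝ → ℝ,
      (∀ i, ∀ t ∈ Icc 0 δ, HasDerivAt (f i) (f (i + 1) t) t) →
      (∀ t ∈ Icc 0 δ, c ≤ |f n t|) → ∀ ε > 0,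
      volume {t | t ∈ Icc 0 δ ∧ |f 0 t| ≤ ε} ≤ ENNReal.ofReal (A * ε ^ τ) := by
  rcases Nat.eq_zero_or_pos n with rfl | hn
  · refine ⟨c⁻¹, 1, by positivity, one_pos, fun δ hδ f _ hfc ε hε => ?_⟩
    rcases lt_or_ge ε c with h | h
    · have : {t | t ∈ Icc 0 δ ∧ |f 0 t| ≤ ε} = ∅ := by
        ext t
        simp only [mem_ofPred_eq, mem_empty_iff_false, iff_false, not_and]
        exact fun ht h' => absurd (hfc t ht) (by linarith)
      rw [this, measure_empty]
      exact zero_le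
    · refine (measure_mono (t := Icc 0 δ) fun t ht => ht.1).trans ?_
      rw [Real.volume_Icc, Real.rpow_one]
      refine ENNReal.ofReal_le_ofReal ?_
      have : 1 ≤ c⁻¹ * ε := by rw [inv_mul_eq_div, one_le_div hc]; exact h
      linarith [hδ.2]
  · refine ⟨2 * (2 ^ n : ℕ) * (2 * (2 / c) ^ (n : ℝ)⁻¹), (n : ℝ)⁻¹, by positivity, by positivity,
      fun δ hδ f hf hfc ε hε => ?_⟩
    by_contra! hcon
    -- Chosen so that ε(2/η)^n = c/2 < c, which contradicts the lower bound on the n-th derivative.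
    set η := 2 * (2 / c * ε) ^ (n : ℝ)⁻¹ with hη
    have hη0 : 0 < η := by positivity
    have hval : 2 * (2 ^ n : ℕ) * (2 * (2 / c) ^ (n : ℝ)⁻¹) * ε ^ (n : ℝ)⁻¹ =
        2 * (2 ^ n : ℕ) * η := by
      rw [hη, Real.mul_rpow (by positivity) hε.le]; ring
    rw [hval] at hcon
    obtain ⟨x, hx, hx'⟩ := exists_separated_of_lt_volume hη0 _ _
      ⟨0, fun t ht => ht.1.1⟩ hcon
    obtain ⟨ξ, hξ, h⟩ := exists_abs_deriv_le_of_separated ordConnected_Icc hη0 n f ε hf x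
      (fun i hi => hx i hi.le) (fun i hi => hx' i (by omega))
    have hpow : (2 / η) ^ n = (2 / c * ε)⁻¹ := by
      rw [hη, div_mul_cancel_left₀ two_ne_zero, inv_pow, ← Real.rpow_natCast, ← Real.rpow_mul (by positivity),
        inv_mul_cancel₀ (by positivity), Real.rpow_one]
    rw [hpow, mul_inv, mul_comm, inv_mul_cancel_right₀ hε.ne'] at h
    have := hfc ξ hξ
    rw [inv_div] at h
    linarith

/-! ### Holomorphic functions on short parallel segments. -/

section Slices

variable {H : Type*} [NormedAddCommGroup H] [NormedSpace ℂ H] {Ω : Set H} {f : H → ℂ}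

lemma analyticAt_slice (hΩ : IsOpen Ω) (hf : DifferentiableOn ℂ f Ω) (z w : H) {ζ : ℂ}
    (h : z + ζ • w ∈ Ω) : AnalyticAt ℂ (fun ζ : ℂ => f (z + ζ • w)) ζ := by
  have hline : Differentiable ℂ fun ζ : ℂ => z + ζ • w := by fun_prop
  refine DifferentiableOn.analyticAt (s := {ζ : ℂ | z + ζ • w ∈ Ω})
    (hf.comp hline.differentiableOn fun ζ hζ => hζ) ?_
  exact (hΩ.preimage hline.continuous).mem_nhds h

/-- The derivatives in a fixed direction of a holomorphic function are continuous. -/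
lemma continuousAt_iteratedDeriv_slice (hΩ : IsOpen Ω) (hf : DifferentiableOn ℂ f Ω) (w : H)
    (m : ℕ) {z₀ : H} (hz₀ : z₀ ∈ Ω) :
    ContinuousAt (fun z => iteratedDeriv m (fun ζ : ℂ => f (z + ζ • w)) 0) z₀ := by
  have hcont : Continuous fun q : H × ℂ => q.1 + q.2 • w := by fun_prop
  have hnhds : ∀ᶠ q : H × ℂ in nhds (z₀, 0), q.1 + q.2 • w ∈ Ω :=
    hcont.continuousAt.eventually_mem (hΩ.mem_nhds (by simpa using hz₀))
  obtain ⟨R, hR, hball⟩ := Metric.nhds_basis_closedBall.eventually_iff.1 hnhds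
  have hmem : ∀ z ∈ closedBall z₀ R, ∀ ζ ∈ closedBall (0 : ℂ) R, z + ζ • w ∈ Ω := by
    intro z hz ζ hζ
    refine @hball (z, ζ) ?_
    rw [← closedBall_prod_same]
    exact ⟨hz, hζ⟩
  have hfc : ∀ z ∈ closedBall z₀ R, ∀ ζ ∈ closedBall (0 : ℂ) R,
      ContinuousAt (fun q : H × ℂ => f (q.1 + q.2 • w)) (z, ζ) := by
    intro z hz ζ hζ
    exact ContinuousAt.comp (f := fun q : H × ℂ => q.1 + q.2 • w) (x := (z, ζ))
      (hf.continuousOn.continuousAt (hΩ.mem_nhds (hmem z hz ζ hζ))) hcont.continuousAt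
  have hz₀' : z₀ ∈ closedBall z₀ R := mem_closedBall_self hR.le
  rw [ContinuousAt, Metric.tendsto_nhds]
  intro e he
  -- With this bound on the circle of radius R, Cauchy's estimate bounds the m-th derivative of the
  -- difference by e/2.
  set e' := e * R ^ m / (2 * m.factorial) with he'
  have he'0 : 0 < e' := by positivity
  have hunif : ∀ᶠ z in nhds z₀, ∀ ζ ∈ closedBall (0 : ℂ) R,
      dist (f (z + ζ • w)) (f (z₀ + ζ • w)) < e' := by
    refine (isCompact_closedBall (0 : ℂ) R).eventually_forall_of_forall_eventually fun ζ hζ => ?_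
    have h1 := hfc z₀ hz₀' ζ hζ
    have h2 : ContinuousAt (fun q : H × ℂ => f (z₀ + q.2 • w)) (z₀, ζ) :=
      ContinuousAt.comp (f := fun q : H × ℂ => (z₀, q.2)) (x := (z₀, ζ)) h1 (by fun_prop)
    have h3 := h1.dist h2
    exact h3.eventually_lt continuousAt_const (by simpa using he'0)
  filter_upwards [hunif, closedBall_mem_nhds z₀ hR] with z hz hzR
  have han : ∀ y ∈ closedBall z₀ R, ∀ ζ ∈ closedBall (0 : ℂ) R,
      AnalyticAt ℂ (fun ζ : ℂ => f (y + ζ • w)) ζ := fun y hy ζ hζ =>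
    analyticAt_slice hΩ hf y w (hmem y hy ζ hζ)
  have h0R : (0 : ℂ) ∈ closedBall (0 : ℂ) R := mem_closedBall_self hR.le
  rw [dist_eq_norm, ← iteratedDeriv_fun_sub (han z hzR 0 h0R).contDiffAt
    (han z₀ hz₀' 0 h0R).contDiffAt]
  have hdiff : DiffContOnCl ℂ (fun ζ : ℂ => f (z + ζ • w) - f (z₀ + ζ • w)) (ball 0 R) := by
    refine DifferentiableOn.diffContOnCl fun ζ hζ => ?_
    rw [closure_ball _ hR.ne'] at hζ
    exact ((han z hzR ζ hζ).differentiableAt.sub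
      (han z₀ hz₀' ζ hζ).differentiableAt).differentiableWithinAt
  have := Complex.norm_iteratedDeriv_le_of_forall_mem_sphere_norm_le m hR hdiff (C := e')
    (fun ζ hζ => by
      rw [← dist_eq_norm]; exact (hz ζ (sphere_subset_closedBall hζ)).le)
  refine this.trans_lt ?_
  rw [he']
  have : (m.factorial : ℝ) * (e * R ^ m / (2 * m.factorial)) / R ^ m = e / 2 := by
    have : (m.factorial : ℝ) ≠ 0 := by positivity
    field_simp
  linarith

/-- A one-variable analytic function on a preconnected set which does not vanish identically has a
nonzero derivative of some order at every point. -/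
lemma exists_iteratedDeriv_ne_zero {U : Set ℂ} (hU : IsPreconnected U) {g : ℂ → ℂ}
    (hg : AnalyticOnNhd ℂ g U) {a b : ℂ} (ha : a ∈ U) (hb : b ∈ U) (hgb : g b ≠ 0) :
    ∃ m, iteratedDeriv m g a ≠ 0 := by
  by_contra! h
  have hp := (hg a ha).hasFPowerSeriesAt
  have h0 : FormalMultilinearSeries.ofScalars ℂ (fun n => iteratedDeriv n g a / n.factorial) =
      (0 : FormalMultilinearSeries ℂ ℂ ℂ) := by
    ext n
    simp [h]
  rw [h0] at hp
  exact hgb (hg.eqOn_zero_of_preconnected_of_eventuallyEq_zero hU ha hp.eventually_eq_zero hb)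

/-- Uniform sublevel set estimates for a holomorphic function on short parallel segments. -/
lemma exists_volume_slice_sublevel_le (hΩ : IsOpen Ω) (hconv : Convex ℝ Ω)
    (hf : DifferentiableOn ℂ f Ω) {z₀ z₁ : H} (hz₀ : z₀ ∈ Ω) (hz₁ : z₁ ∈ Ω) (hne : f z₁ ≠ 0) :
    ∃ ρ δ A τ : ℝ, 0 < ρ ∧ 0 < δ ∧ 0 ≤ A ∧ 0 < τ ∧ ∀ x ∈ ball z₀ ρ, ∀ ε > 0,
      volume {s : ℝ | s ∈ Icc 0 δ ∧ ‖f (x + s • (z₁ - z₀))‖ ≤ ε} ≤ ENNReal.ofReal (A * ε ^ τ) := by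
  set w := z₁ - z₀ with hw
  have hU : Convex ℝ {ζ : ℂ | z₀ + ζ • w ∈ Ω} := by
    intro a ha b hb s t hs ht hst
    have := hconv ha hb hs ht hst
    have e : z₀ + (s • a + t • b) • w = s • (z₀ + a • w) + t • (z₀ + b • w) := by
      have : z₀ = s • z₀ + t • z₀ := by rw [← add_smul, hst, one_smul]
      rw [smul_add, smul_add, add_smul, smul_assoc, smul_assoc]
      nth_rewrite 1 [this]
      abel
    simpa only [mem_ofPred_eq, e] using this
  obtain ⟨m, hm⟩ := exists_iteratedDeriv_ne_zero hU.isPreconnected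
    (g := fun ζ : ℂ => f (z₀ + ζ • w)) (fun ζ hζ => analyticAt_slice hΩ hf z₀ w hζ) (a := 0)
    (b := 1) (by simpa using hz₀) (by simpa [hw] using hz₁) (by simpa [hw] using hne)
  set D : H → ℂ := fun z => iteratedDeriv m (fun ζ : ℂ => f (z + ζ • w)) 0 with hD
  set u := D z₀ with hu
  have hu0 : 0 < ‖u‖ := norm_pos_iff.2 hm
  -- The sublevel estimate is for real functions, so f is replaced by Re(ū f). Its m-th derivative
  -- along w stays above |u|²/2 near z₀, and |f| ≤ ε implies |Re(ū f)| ≤ |u|ε.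
  have hre : ContinuousAt (fun z => (starRingEnd ℂ u * D z).re) z₀ :=
    Complex.continuous_re.continuousAt.comp
      (continuousAt_const.mul (continuousAt_iteratedDeriv_slice hΩ hf w m hz₀))
  have hval : (starRingEnd ℂ u * D z₀).re = ‖u‖ ^ 2 := by
    rw [← hu, mul_comm, Complex.mul_conj, Complex.ofReal_re, Complex.normSq_eq_norm_sq]
  have hc : 0 < ‖u‖ ^ 2 / 2 := by positivity
  obtain ⟨ρ, hρ, hball⟩ := Metric.eventually_nhds_iff_ball.1
    ((hre.eventually_const_lt (show ‖u‖ ^ 2 / 2 < (starRingEnd ℂ u * D z₀).re by rw [hval]; linarith)).and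
      (hΩ.mem_nhds hz₀))
  obtain ⟨A, τ, hA, hτ, hAτ⟩ := exists_volume_sublevel_le m hc
  set δ := min 1 (ρ / (2 * (‖w‖ + 1))) with hδ
  have hδ0 : 0 < δ := by positivity
  have hδw : δ * ‖w‖ < ρ / 2 := by
    have h1 : δ ≤ ρ / (2 * (‖w‖ + 1)) := min_le_right _ _
    rw [le_div_iff₀ (by positivity)] at h1
    nlinarith [norm_nonneg w]
  refine ⟨ρ / 2, δ, A * ‖u‖ ^ τ, τ, by positivity, hδ0, by positivity, hτ, fun x hx ε hε => ?_⟩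
  have hmem : ∀ s ∈ Icc (0 : ℝ) δ, x + (s : ℂ) • w ∈ ball z₀ ρ := by
    intro s hs
    rw [mem_ball, dist_eq_norm] at hx ⊢
    have e : x + (s : ℂ) • w - z₀ = (x - z₀) + (s : ℂ) • w := by abel
    rw [e]
    refine (norm_add_le _ _).trans_lt ?_
    rw [norm_smul, Complex.norm_real, Real.norm_of_nonneg hs.1]
    have := mul_le_mul_of_nonneg_right hs.2 (norm_nonneg w)
    linarith
  set g : ℂ → ℂ := fun ζ => f (x + ζ • w) with hg
  have key := hAτ δ ⟨hδ0, min_le_left _ _⟩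
    (fun i s => (starRingEnd ℂ u * iteratedDeriv i g s).re) (fun i s hs => ?_) (fun s hs => ?_)
    (‖u‖ * ε) (by positivity)
  · rw [Real.mul_rpow (norm_nonneg _) hε.le, ← mul_assoc] at key
    refine (measure_mono ?_).trans key
    rintro s ⟨hs, hs'⟩
    refine ⟨hs, ?_⟩
    simp only [iteratedDeriv_zero]
    refine (Complex.abs_re_le_norm _).trans ?_
    rw [norm_mul, RCLike.norm_conj]
    exact mul_le_mul_of_nonneg_left hs' (norm_nonneg _)
  · have han := analyticAt_slice hΩ hf x w (hball _ (hmem s hs)).2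
    have hd : HasDerivAt (iteratedDeriv i g) (iteratedDeriv (i + 1) g s) s := by
      rw [iteratedDeriv_succ, iteratedDeriv_eq_iterate]
      exact (han.iterated_deriv i).differentiableAt.hasDerivAt
    exact (hd.const_mul (starRingEnd ℂ u)).real_of_complex
  · have h1 := (hball _ (hmem s hs)).1
    have h2 : D (x + (s : ℂ) • w) = iteratedDeriv m g s := by
      have : (fun ζ : ℂ => f (x + (s : ℂ) • w + ζ • w)) = fun ζ => g (s + ζ) := by
        ext ζ
        simp only [hg, add_smul, add_assoc]
      simp only [hD, this]
      rw [iteratedDeriv_comp_const_add]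
      simp only [add_zero]
    rw [h2] at h1
    exact h1.le.trans (le_abs_self _)

end Slices

/-! ### Local integrability of log|f| on a real affine subspace. -/

section LogIntegrable

variable {E : Type*} [NormedAddCommGroup E] [NormedSpace ℝ E] [MeasurableSpace E]
  [BorelSpace E] [FiniteDimensional ℝ E] (μ : Measure E) [μ.IsAddHaarMeasure]

/-- If a set meets all short segments in direction `v` in small measure, it has small measure. -/
lemma measure_le_of_slices {S : Set E} (hS : MeasurableSet S) {p v : E} {ρ δ : ℝ}
    (hδv : δ * ‖v‖ ≤ ρ) (hSρ : S ⊆ ball p ρ) {a : ℝ≥0∞}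
    (ha : ∀ x ∈ ball p (2 * ρ), volume {s : ℝ | s ∈ Icc 0 δ ∧ x + s • v ∈ S} ≤ a) :
    ENNReal.ofReal δ * μ S ≤ a * μ (ball p (2 * ρ)) := by
  have hm : Measurable fun q : ℝ × E => q.2 + q.1 • v := by fun_prop
  have e := Measure.prod_apply (μ := volume.restrict (Icc 0 δ)) (ν := μ) (hm hS)
  rw [Measure.prod_apply_symm (hm hS)] at e
  -- By translation invariance every shift of S has the measure of S; the other order of integration
  -- sees the segments.
  have e1 : ∫⁻ s in Icc 0 δ, μ (Prod.mk s ⁻¹' ((fun q : ℝ × E => q.2 + q.1 • v) ⁻¹' S)) =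
      ENNReal.ofReal δ * μ S := by
    have : ∀ s : ℝ, μ (Prod.mk s ⁻¹' ((fun q : ℝ × E => q.2 + q.1 • v) ⁻¹' S)) = μ S := fun s =>
      measure_preimage_add_right μ (s • v) S
    simp only [this, lintegral_const, Measure.restrict_apply_univ, Real.volume_Icc, sub_zero]
    rw [mul_comm]
  rw [← e1, ← e]
  have : a * μ (ball p (2 * ρ)) = ∫⁻ x, (ball p (2 * ρ)).indicator (fun _ => a) x ∂μ := by
    rw [lintegral_indicator_const measurableSet_ball]
  rw [this]
  refine lintegral_mono fun x => ?_
  rw [Measure.restrict_apply' measurableSet_Icc]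
  by_cases hx : x ∈ ball p (2 * ρ)
  · rw [indicator_of_mem hx]
    refine le_trans (measure_mono ?_) (ha x hx)
    exact fun s hs => ⟨hs.2, hs.1⟩
  · rw [indicator_of_notMem hx, nonpos_iff_eq_zero]
    refine measure_mono_null (t := ∅) (fun s hs => hx ?_) measure_empty
    have h1 := hSρ hs.1
    simp only [mem_ball, dist_eq_norm] at h1 ⊢
    have h2 : ‖s • v‖ ≤ ρ := by
      rw [norm_smul, Real.norm_of_nonneg hs.2.1]
      exact (mul_le_mul_of_nonneg_right hs.2.2 (norm_nonneg v)).trans hδv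
    calc ‖x - p‖ = ‖(x + s • v - p) - s • v‖ := by congr 1; abel
      _ ≤ ‖x + s • v - p‖ + ‖s • v‖ := norm_sub_le _ _
      _ < 2 * ρ := by linarith

variable {H : Type*} [NormedAddCommGroup H] [NormedSpace ℂ H] {Ω : Set H} {f : H → ℂ}

/-- Slicing near p in the direction x₀ - p works because f does not vanish identically on the line
through p and x₀. Fubini then turns the uniform estimate on slices into one in E. -/
lemma exists_measure_sublevel_le (hΩ : IsOpen Ω) (hconv : Convex ℝ Ω)
    (hf : DifferentiableOn ℂ f Ω) (ι : E →ᵃⁱ[ℝ] H) {x₀ p : E} (hx₀ : ι x₀ ∈ Ω)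
    (hne : f (ι x₀) ≠ 0) (hp : ι p ∈ Ω) :
    ∃ ρ A τ : ℝ, 0 < ρ ∧ 0 < τ ∧ (∀ x ∈ ball p ρ, ι x ∈ Ω) ∧
      ∀ ε > 0, μ {x | x ∈ ball p ρ ∧ ‖f (ι x)‖ ≤ ε} ≤ ENNReal.ofReal (A * ε ^ τ) := by
  obtain ⟨ρ₁, δ₁, A, τ, hρ₁, hδ₁, hA, hτ, h⟩ :=
    exists_volume_slice_sublevel_le hΩ hconv hf hp hx₀ hne
  obtain ⟨ρ₂, hρ₂, hball⟩ := Metric.mem_nhds_iff.1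
    (ι.continuous.continuousAt.preimage_mem_nhds (hΩ.mem_nhds hp))
  set ρ := min (ρ₁ / 2) (ρ₂ / 2) with hρ
  have hρ0 : 0 < ρ := by positivity
  set v := x₀ - p with hv
  set δ := min δ₁ (ρ / (‖v‖ + 1))
  have hδ0 : 0 < δ := by positivity
  have hδv : δ * ‖v‖ ≤ ρ := by
    have : δ ≤ ρ / (‖v‖ + 1) := min_le_right _ _
    rw [le_div_iff₀ (by positivity)] at this
    nlinarith [norm_nonneg v]
  have hsub : ∀ x ∈ ball p ρ, ι x ∈ Ω := fun x hx =>
    hball (ball_subset_ball (by linarith [min_le_right (ρ₁ / 2) (ρ₂ / 2)]) hx)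
  refine ⟨ρ, δ⁻¹ * A * (μ (ball p (2 * ρ))).toReal, τ, hρ0, hτ, hsub, fun ε hε => ?_⟩
  have hline : ∀ (x : E) (s : ℝ), ι (x + s • v) = ι x + s • (ι x₀ - ι p) := by
    intro x s
    have h1 := ι.map_vadd x (s • v)
    have h2 := ι.map_vsub x₀ p
    simp only [vadd_eq_add, vsub_eq_sub] at h1 h2
    rw [add_comm, h1, map_smul, hv, h2, add_comm]
  have hcont : ContinuousOn (fun x => ‖f (ι x)‖) (ball p ρ) :=
    (hf.continuousOn.comp ι.continuous.continuousOn hsub).norm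
  have hS : MeasurableSet {x | x ∈ ball p ρ ∧ ‖f (ι x)‖ ≤ ε} := by
    obtain ⟨T, hT, hTe⟩ := continuousOn_iff_isClosed.1 hcont (Iic ε) isClosed_Iic
    have : {x | x ∈ ball p ρ ∧ ‖f (ι x)‖ ≤ ε} = T ∩ ball p ρ := by
      rw [← hTe, inter_comm]; rfl
    rw [this]
    exact hT.measurableSet.inter measurableSet_ball
  have key := measure_le_of_slices μ hS hδv (fun x hx => hx.1)
    (a := ENNReal.ofReal (A * ε ^ τ)) (fun x hx => ?_)
  · have hfin : μ (ball p (2 * ρ)) ≠ ∞ := measure_ball_lt_top.ne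
    have e : δ⁻¹ * A * (μ (ball p (2 * ρ))).toReal * ε ^ τ =
        δ⁻¹ * (A * ε ^ τ * (μ (ball p (2 * ρ))).toReal) := by ring
    rw [e, ENNReal.ofReal_mul (by positivity), ENNReal.ofReal_mul (by positivity),
      ENNReal.ofReal_toReal hfin, ENNReal.ofReal_inv_of_pos hδ0,
      ← ENNReal.mul_le_iff_le_inv (by simpa using hδ0) ENNReal.ofReal_ne_top]
    exact key
  · refine (measure_mono ?_).trans (h (ι x) ?_ ε hε)
    · rintro s ⟨hs, hs'⟩
      refine ⟨⟨hs.1, hs.2.trans (min_le_left _ _)⟩, ?_⟩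
      rw [← hline]
      exact hs'.2
    · rw [mem_ball, ι.dist_map]
      exact lt_of_lt_of_le hx (by linarith [min_le_left (ρ₁ / 2) (ρ₂ / 2)])

/-- The logarithm of the modulus of a holomorphic function, restricted to a real affine subspace, is
integrable on compact sets, and its zero set there is a null set. -/
lemma integrableOn_log_norm_of_isCompact (hΩ : IsOpen Ω) (hconv : Convex ℝ Ω)
    (hf : DifferentiableOn ℂ f Ω) (ι : E →ᵃⁱ[ℝ] H) {x₀ : E} (hx₀ : ι x₀ ∈ Ω)
    (hne : f (ι x₀) ≠ 0) {K : Set E} (hK : IsCompact K) (hKΩ : ∀ x ∈ K, ι x ∈ Ω) :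
    IntegrableOn (fun x => Real.log ‖f (ι x)‖) K μ ∧ μ {x | x ∈ K ∧ f (ι x) = 0} = 0 := by
  refine hK.induction_on (p := fun K => IntegrableOn (fun x => Real.log ‖f (ι x)‖) K μ ∧
    μ {x | x ∈ K ∧ f (ι x) = 0} = 0) (by simp) (fun s t hst h => ⟨h.1.mono_set hst, ?_⟩)
    (fun s t hs ht => ⟨hs.1.union ht.1, ?_⟩) (fun p hp => ?_)
  · refine measure_mono_null ?_ h.2
    exact fun x hx => ⟨hst hx.1, hx.2⟩
  · refine measure_mono_null ?_ (measure_union_null hs.2 ht.2)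
    exact fun x hx => hx.1.elim (fun h => .inl ⟨h, hx.2⟩) (fun h => .inr ⟨h, hx.2⟩)
  obtain ⟨ρ, A, τ, hρ, hτ, hsub, hA⟩ :=
    exists_measure_sublevel_le μ hΩ hconv hf ι hx₀ hne (hKΩ p hp)
  have hcont : ContinuousOn (fun x => ‖f (ι x)‖) (ball p ρ) :=
    (hf.continuousOn.comp ι.continuous.continuousOn hsub).norm
  have hcp := hcont.continuousAt (ball_mem_nhds p hρ)
  obtain ⟨ρ', hρ', hρ'b⟩ := Metric.eventually_nhds_iff_ball.1
    (hcp.eventually_lt_const (lt_add_one _))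
  set M := ‖f (ι p)‖ + 1 with hM
  have hM1 : 1 ≤ M := by simp [hM]
  set r := min ρ ρ' with hr
  have hr0 : 0 < r := lt_min hρ hρ'
  have hrρ : ball p r ⊆ ball p ρ := ball_subset_ball (min_le_left _ _)
  refine ⟨ball p r, mem_nhdsWithin_of_mem_nhds (ball_mem_nhds p hr0), ?_, ?_⟩
  · have hmeas : AEMeasurable (fun x => ‖f (ι x)‖) (μ.restrict (ball p r)) :=
      (hcont.mono hrρ).aemeasurable measurableSet_ball
    have hmeas' : AEMeasurable (fun x => Real.log ‖f (ι x)‖) (μ.restrict (ball p r)) :=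
      Real.measurable_log.comp_aemeasurable hmeas
    refine ⟨hmeas'.aestronglyMeasurable, ?_⟩
    have hbound : ∀ x ∈ ball p r, ‖Real.log ‖f (ι x)‖‖ₑ ≤
        ENNReal.ofReal (max (-Real.log ‖f (ι x)‖) 0) + ENNReal.ofReal (Real.log M) := by
      intro x hx
      have hlogM := Real.log_nonneg hM1
      rw [← ENNReal.ofReal_add (le_max_right _ _) hlogM, Real.enorm_eq_ofReal_abs]
      refine ENNReal.ofReal_le_ofReal ?_
      have hxM : ‖f (ι x)‖ < M := hρ'b x (ball_subset_ball (min_le_right _ _) hx)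
      refine abs_le'.2 ⟨?_, by linarith [le_max_left (-Real.log ‖f (ι x)‖) 0]⟩
      have : Real.log ‖f (ι x)‖ ≤ Real.log M := by
        -- At a zero of f, `Real.log` returns 0, which is still at most log M because M ≥ 1.
        rcases (norm_nonneg (f (ι x))).eq_or_lt with h0 | h0
        · rw [← h0, Real.log_zero]; exact hlogM
        · exact Real.log_le_log h0 hxM.le
      linarith [le_max_right (-Real.log ‖f (ι x)‖) 0]
    refine (setLIntegral_mono' measurableSet_ball hbound).trans_lt ?_
    rw [lintegral_add_right _ measurable_const]
    refine ENNReal.add_lt_top.2 ⟨?_, ?_⟩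
    · have hmax : AEMeasurable (fun x => max (-Real.log ‖f (ι x)‖) 0) (μ.restrict (ball p r)) :=
        hmeas'.neg.max aemeasurable_const
      -- Layer cake: for t > 0 the set where the negative part of the logarithm is at least t lies
      -- in {|f| ≤ e^{-t}}, of measure at most A e^{-τt}.
      rw [lintegral_eq_lintegral_meas_le (f := fun x => max (-Real.log ‖f (ι x)‖) 0) _
        (Filter.Eventually.of_forall fun x => le_max_right _ _)
        hmax]
      have hneg : -τ < 0 := by linarith
      refine lt_of_le_of_lt (setLIntegral_mono' measurableSet_Ioi (g := fun t =>
        ENNReal.ofReal (A * Real.exp (-τ * t))) fun t ht => ?_) ?_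
      · rw [Measure.restrict_apply' measurableSet_ball]
        have := hA (Real.exp (-t)) (Real.exp_pos _)
        rw [← Real.exp_mul, show -t * τ = -τ * t by ring] at this
        refine (measure_mono ?_).trans this
        rintro x ⟨hx, hxb⟩
        refine ⟨hrρ hxb, ?_⟩
        have hx' : t ≤ max (-Real.log ‖f (ι x)‖) 0 := hx
        have ht' : 0 < t := ht
        rcases le_max_iff.1 hx' with h | h
        · rcases (norm_nonneg (f (ι x))).eq_or_lt with h0 | h0
          · rw [← h0]; positivity
          · rw [← Real.log_le_iff_le_exp h0]; linarith
        · linarith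
      · exact ((integrableOn_exp_mul_Ioi hneg 0).const_mul A).lintegral_lt_top
    · rw [setLIntegral_const]
      exact ENNReal.mul_lt_top ENNReal.ofReal_lt_top measure_ball_lt_top
  · have hlim : Filter.Tendsto (fun ε : ℝ => ENNReal.ofReal (A * ε ^ τ)) (nhdsWithin 0 (Ioi 0))
        (nhds 0) := by
      have h1 : ContinuousAt (fun ε : ℝ => A * ε ^ τ) 0 :=
        continuousAt_const.mul (Real.continuousAt_rpow_const _ _ (.inr hτ.le))
      have h2 := ENNReal.tendsto_ofReal (h1.tendsto.mono_left (nhdsWithin_le_nhds (s := Ioi 0)))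
      simpa [Real.zero_rpow hτ.ne'] using h2
    refine le_antisymm (ge_of_tendsto hlim ?_) zero_le
    filter_upwards [self_mem_nhdsWithin] with ε hε
    refine le_trans (measure_mono ?_) (hA ε hε)
    rintro x ⟨hx, hx0⟩
    refine ⟨hrρ hx, ?_⟩
    rw [hx0, norm_zero]
    exact le_of_lt hε

end LogIntegrable

/-! ### Log-concave functions: measurability and boundedness. -/

lemma Convex.interior_nonempty_of_measure_ne_zero {E : Type*} [NormedAddCommGroup E]
    [NormedSpace ℝ E] [MeasurableSpace E] [BorelSpace E] [FiniteDimensional ℝ E] (μ : Measure E)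
    [μ.IsAddHaarMeasure] {s : Set E} (hs : Convex ℝ s) (h : μ s ≠ 0) : (interior s).Nonempty := by
  rw [nonempty_iff_ne_empty]
  intro he
  refine h (measure_mono_null ?_ (hs.addHaar_frontier μ))
  rw [frontier, he, sdiff_empty]
  exact subset_closure

lemma measurable_indicator_of_continuousOn {E : Type*} [TopologicalSpace E] [MeasurableSpace E]
    [OpensMeasurableSpace E] {s : Set E} (hs : MeasurableSet s) {f : E → ℝ}
    (hf : ContinuousOn f s) : Measurable (s.indicator f) := by
  classical
  rw [← piecewise_eq_indicator]
  exact hf.measurable_piecewise continuousOn_const hs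

namespace IsLogConcave

variable {k : ℕ} {h : EuclideanSpace ℝ (Fin k) → ℝ}

lemma convex_pos (hh : IsLogConcave h) : Convex ℝ {x | 0 < h x} := hh.concaveOn_log.1

lemma rpow_mul_rpow_le (hh : IsLogConcave h) {x y : EuclideanSpace ℝ (Fin k)} (hx : 0 < h x)
    (hy : 0 < h y) {t : ℝ} (ht : t ∈ Icc (0 : ℝ) 1) :
    h x ^ (1 - t) * h y ^ t ≤ h ((1 - t) • x + t • y) := by
  have t0 : 0 ≤ 1 - t := sub_nonneg.2 ht.2
  have h1 := hh.concaveOn_log.2 hx hy t0 ht.1 (by ring)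
  have h2 : 0 < h ((1 - t) • x + t • y) := hh.convex_pos hx hy t0 ht.1 (by ring)
  rw [Real.rpow_def_of_pos hx, Real.rpow_def_of_pos hy, ← Real.exp_add, ← Real.le_log_iff_exp_le h2]
  simp only [smul_eq_mul] at h1
  linarith

/-- The frontier of a convex set is null. This replaces h, not assumed measurable, by a measurable
function: on the interior log h is concave, hence continuous. -/
lemma ae_eq_indicator_interior (hh : IsLogConcave h) :
    h =ᵐ[volume] (interior {x | 0 < h x}).indicator h := by
  have hf := hh.convex_pos.addHaar_frontier (volume : Measure (EuclideanSpace ℝ (Fin k)))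
  filter_upwards [measure_eq_zero_iff_ae_notMem.1 hf] with x hx
  by_cases hxi : x ∈ interior {x | 0 < h x}
  · rw [indicator_of_mem hxi]
  · rw [indicator_of_notMem hxi]
    by_contra hne
    exact hx ⟨subset_closure (lt_of_le_of_ne (hh.nonneg x) (Ne.symm hne)), hxi⟩

lemma measurable_indicator_interior (hh : IsLogConcave h) :
    Measurable ((interior {x | 0 < h x}).indicator h) := by
  have hc : ContinuousOn h (interior {x | 0 < h x}) := by
    refine (Real.continuous_exp.comp_continuousOn hh.concaveOn_log.continuousOn_interior).congr
      fun x hx => ?_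
    exact (Real.exp_log (show 0 < h x from interior_subset (s := {x | 0 < h x}) hx)).symm
  exact measurable_indicator_of_continuousOn isOpen_interior.measurableSet hc

lemma densityMeasure_eq (hh : IsLogConcave h) :
    densityMeasure h = densityMeasure ((interior {x | 0 < h x}).indicator h) :=
  withDensity_congr_ae (hh.ae_eq_indicator_interior.mono fun x hx => by simp only [hx])

lemma ae_mem_interior (hh : IsLogConcave h) :
    ∀ᵐ x ∂(densityMeasure h), x ∈ interior {x | 0 < h x} := by
  have hm : Measurable fun x => ENNReal.ofReal ((interior {x | 0 < h x}).indicator h x) :=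
    ENNReal.measurable_ofReal.comp hh.measurable_indicator_interior
  rw [hh.densityMeasure_eq, densityMeasure, ae_withDensity_iff hm]
  refine Filter.Eventually.of_forall fun x hx => ?_
  by_contra hxi
  simp [hxi] at hx

/-- A log-concave function with finite nonzero integral is bounded. -/
lemma exists_le (hh : IsLogConcave h) (h0 : densityMeasure h univ ≠ 0)
    (h1 : densityMeasure h univ ≠ ∞) : ∃ B : ℝ, ∀ x, h x ≤ B := by
  have hvol : volume {x | 0 < h x} ≠ 0 := by
    intro hz
    apply h0
    rw [densityMeasure, withDensity_apply _ MeasurableSet.univ, Measure.restrict_univ]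
    rw [lintegral_eq_zero_of_ae_eq_zero]
    filter_upwards [measure_eq_zero_iff_ae_notMem.1 hz] with x hx
    exact ENNReal.ofReal_eq_zero.2 (not_lt.1 hx)
  have hUn : {x | 0 < h x} = ⋃ n : ℕ, {x | (1 : ℝ) / (n + 1) ≤ h x} := by
    ext x
    simp only [mem_ofPred_eq, mem_iUnion]
    refine ⟨fun hx => (exists_nat_one_div_lt hx).imp fun n hn => hn.le, fun ⟨n, hn⟩ => ?_⟩
    exact lt_of_lt_of_le (by positivity) hn
  obtain ⟨n, hn⟩ : ∃ n : ℕ, volume {x | (1 : ℝ) / (n + 1) ≤ h x} ≠ 0 := by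
    by_contra! hcon
    exact hvol (by rw [hUn]; exact measure_iUnion_null hcon)
  set c : ℝ := 1 / (n + 1) with hc
  have hc0 : 0 < c := by positivity
  have hconv : Convex ℝ {x | c ≤ h x} := by
    have := hh.concaveOn_log.convex_ge (Real.log c)
    convert this using 1
    ext x
    simp only [mem_ofPred_eq]
    refine ⟨fun hx => ⟨hc0.trans_le hx, Real.log_le_log hc0 hx⟩, fun hx => ?_⟩
    exact (Real.log_le_log_iff hc0 hx.1).1 hx.2
  obtain ⟨y₀, hy₀⟩ := hconv.interior_nonempty_of_measure_ne_zero volume hn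
  obtain ⟨ρ, hρ, hball⟩ := Metric.mem_nhds_iff.1 (mem_interior_iff_mem_nhds.1 hy₀)
  set vB := volume (ball (0 : EuclideanSpace ℝ (Fin k)) (ρ / 2)) with hvB
  have hvB0 : vB ≠ 0 := (measure_ball_pos _ _ (by positivity)).ne'
  have hvB1 : vB ≠ ∞ := measure_ball_lt_top.ne
  set T := (densityMeasure h univ / vB).toReal with hT
  have hTt : densityMeasure h univ / vB ≠ ∞ := ENNReal.div_ne_top h1 hvB0
  refine ⟨T ^ 2 / c, fun x => ?_⟩
  rcases (hh.nonneg x).eq_or_lt with hx | hx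
  · rw [← hx]; positivity
  -- Such z is the midpoint of x and a point of a ball where h ≥ c. The volume of the half-size ball
  -- does not depend on x, so the finite total mass bounds h(x).
  have hlow : ∀ z ∈ ball ((1 / 2 : ℝ) • (x + y₀)) (ρ / 2), √(h x * c) ≤ h z := by
    intro z hz
    set y := (2 : ℝ) • z - x with hy
    have hyb : y ∈ ball y₀ ρ := by
      rw [mem_ball, dist_eq_norm] at hz ⊢
      have : y - y₀ = (2 : ℝ) • (z - (1 / 2 : ℝ) • (x + y₀)) := by
        rw [hy]; module
      rw [this, norm_smul, Real.norm_of_nonneg zero_le_two]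
      linarith
    have hyc : c ≤ h y := hball hyb
    have hz' : (1 - 1 / 2 : ℝ) • x + (1 / 2 : ℝ) • y = z := by
      rw [hy]; module
    have := hh.rpow_mul_rpow_le hx (hc0.trans_le hyc) (t := 1 / 2) (by norm_num)
    rw [hz'] at this
    refine le_trans ?_ this
    rw [show (1 - 1 / 2 : ℝ) = 1 / 2 by norm_num, ← Real.sqrt_eq_rpow, ← Real.sqrt_eq_rpow,
      ← Real.sqrt_mul hx.le]
    gcongr
  have hint : ENNReal.ofReal √(h x * c) * vB ≤ densityMeasure h univ := by
    rw [densityMeasure, withDensity_apply _ MeasurableSet.univ, Measure.restrict_univ]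
    have : vB = volume (ball ((1 / 2 : ℝ) • (x + y₀)) (ρ / 2)) := by
      exact (Measure.addHaar_ball_center volume _ _).symm
    rw [this, ← setLIntegral_const]
    exact (setLIntegral_mono' measurableSet_ball fun z hz =>
      ENNReal.ofReal_le_ofReal (hlow z hz)).trans (setLIntegral_le_lintegral _ _)
  rw [← ENNReal.le_div_iff_mul_le (.inl hvB0) (.inl hvB1), ENNReal.ofReal_le_iff_le_toReal hTt,
    Real.sqrt_le_left ENNReal.toReal_nonneg] at hint
  rw [le_div_iff₀ hc0]
  exact hint

end IsLogConcave

lemma densityMeasure_le {k : ℕ} {h : EuclideanSpace ℝ (Fin k) → ℝ} {B : ℝ} (hB : ∀ x, h x ≤ B) :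
    densityMeasure h ≤ ENNReal.ofReal B • volume := by
  rw [← withDensity_const]
  exact withDensity_mono (Filter.Eventually.of_forall fun x => ENNReal.ofReal_le_ofReal (hB x))

/-- The mean oscillation around the mean is at most twice the mean oscillation around any
constant. -/
lemma integral_abs_sub_integral_le {α : Type*} [MeasurableSpace α] {ν : Measure α}
    [IsProbabilityMeasure ν] {u : α → ℝ} (hu : Integrable u ν) {M c : ℝ} (hc : 0 ≤ c)
    (h : ∫⁻ x, ENNReal.ofReal |u x - M| ∂ν ≤ ENNReal.ofReal c) :
    ∫ x, |u x - ∫ y, u y ∂ν| ∂ν ≤ 2 * c := by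
  have hM : Integrable (fun x => u x - M) ν := hu.sub (integrable_const M)
  have h1 : ∫ x, |u x - M| ∂ν ≤ c := by
    rw [integral_eq_lintegral_of_nonneg_ae (Filter.Eventually.of_forall fun x => abs_nonneg _)
      hM.abs.aestronglyMeasurable]
    exact ENNReal.toReal_le_of_le_ofReal hc h
  have h2 : |M - ∫ y, u y ∂ν| ≤ c := by
    have : M - ∫ y, u y ∂ν = -∫ y, (u y - M) ∂ν := by
      rw [integral_sub hu (integrable_const M)]; simp
    rw [this, abs_neg]
    exact abs_integral_le_integral_abs.trans h1
  calc ∫ x, |u x - ∫ y, u y ∂ν| ∂ν ≤ ∫ x, (|u x - M| + c) ∂ν := by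
        refine integral_mono (hu.sub (integrable_const _)).abs (hM.abs.add (integrable_const c))
          fun x => ?_
        exact (abs_sub_le (u x) M _).trans (add_le_add_right h2 _)
    _ ≤ 2 * c := by
        rw [integral_add hM.abs (integrable_const c)]
        simp
        linarith

/-! ### From the Remez inequality to mean oscillation. -/

/-- The Remez-type inequality bounds the size of sublevel sets on segments. -/
lemma RemezInequality.volume_sublevel_le {n : ℕ} {f : EuclideanSpace ℂ (Fin n) → ℂ} {d : ℝ≥0}
    (hR : RemezInequality f d) (hd : 0 < d) (hf : ContinuousOn f (ball 0 1))
    {a b : EuclideanSpace ℂ (Fin n)} (ha : a ∈ ball (0 : EuclideanSpace ℂ (Fin n)) 1)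
    (hb : b ∈ ball (0 : EuclideanSpace ℂ (Fin n)) 1) {α s : ℝ} (hα : 0 < α)
    (hs : α * Real.exp (d * s) ≤ ‖f b‖) :
    volume {t : ℝ | t ∈ Icc (0 : ℝ) 1 ∧ ‖f (AffineMap.lineMap a b t)‖ ≤ α} ≤
      ENNReal.ofReal (4 * Real.exp (-s)) := by
  set S := {t : ℝ | t ∈ Icc (0 : ℝ) 1 ∧ ‖f (AffineMap.lineMap a b t)‖ ≤ α} with hS
  have hmem : ∀ t ∈ Icc (0 : ℝ) 1, AffineMap.lineMap a b t ∈ ball (0 : EuclideanSpace ℂ (Fin n)) 1 :=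
    fun t ht => (convex_ball _ _).lineMap_mem ha hb ht
  have hcont : ContinuousOn (fun t : ℝ => ‖f (AffineMap.lineMap a b t)‖) (Icc 0 1) :=
    (hf.comp AffineMap.lineMap_continuous.continuousOn hmem).norm
  have hSm : MeasurableSet S :=
    (hcont.preimage_isClosed_of_isClosed isClosed_Icc (isClosed_Iic (a := α))).measurableSet
  rcases eq_or_ne (volume S) 0 with h0 | h0
  · rw [h0]; exact zero_le
  have hS1 : volume S ≠ ∞ :=
    ne_top_of_le_ne_top (b := volume (Icc (0 : ℝ) 1)) (by simp) (measure_mono fun t ht => ht.1)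
  have h := hR a ha b hb S (fun t ht => ht.1) hSm (pos_iff_ne_zero.2 h0)
  have h1 : ENNReal.ofReal (α * Real.exp (d * s)) ≤
      ⨆ t ∈ Icc (0 : ℝ) 1, ‖f (AffineMap.lineMap a b t)‖ₑ := by
    refine le_trans ?_ (le_iSup₂ (f := fun (t : ℝ) (_ : t ∈ Icc (0 : ℝ) 1) =>
      ‖f (AffineMap.lineMap a b t)‖ₑ) 1 (by simp))
    rw [AffineMap.lineMap_apply_one, ← ofReal_norm]
    exact ENNReal.ofReal_le_ofReal hs
  have h2 : ⨆ t ∈ S, ‖f (AffineMap.lineMap a b t)‖ₑ ≤ ENNReal.ofReal α := by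
    refine iSup₂_le fun t ht => ?_
    rw [← ofReal_norm]
    exact ENNReal.ofReal_le_ofReal ht.2
  have h3 := (h1.trans h).trans (mul_le_mul_right h2 _)
  have hv : 0 < (volume S).toReal := ENNReal.toReal_pos h0 hS1
  have h4 : (4 / volume S : ℝ≥0∞) = ENNReal.ofReal (4 / (volume S).toReal) := by
    rw [ENNReal.ofReal_div_of_pos hv, ENNReal.ofReal_toReal hS1]
    norm_num
  rw [h4, ENNReal.ofReal_rpow_of_pos (by positivity), ← ENNReal.ofReal_mul (by positivity),
    ENNReal.ofReal_le_ofReal_iff (by positivity), mul_comm] at h3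
  have h5 := le_of_mul_le_mul_right h3 hα
  rw [mul_comm, Real.exp_mul, Real.rpow_le_rpow_iff (Real.exp_pos _).le (by positivity)
    (NNReal.coe_pos.2 hd), le_div_iff₀ hv] at h5
  rw [← ENNReal.ofReal_toReal hS1]
  refine ENNReal.ofReal_le_ofReal ?_
  rw [Real.exp_neg, ← div_eq_mul_inv, le_div_iff₀ (Real.exp_pos _), mul_comm]
  exact h5

/-- `logConcave_mean_oscillation` on Euclidean space, for an unnormalized density which is positive
on an open convex set. -/
lemma mean_oscillation_le_of_remez {k : ℕ} {h : EuclideanSpace ℝ (Fin k) → ℝ}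
    (hh : IsLogConcave h) (h0 : densityMeasure h univ ≠ 0) (h1 : densityMeasure h univ ≠ ∞)
    {φ : EuclideanSpace ℝ (Fin k) → ℝ} (hφ0 : ∀ x, 0 ≤ φ x)
    (hφ : ContinuousOn φ (interior {x | 0 < h x}))
    (hφ1 : ∀ᵐ x ∂(densityMeasure h), φ x ≠ 0) {d : ℝ} (hd : 0 < d)
    (hR : ∀ x ∈ interior {x | 0 < h x}, ∀ y ∈ interior {x | 0 < h x}, ∀ α, 0 < α → ∀ s : ℝ,
      α * Real.exp (d * s) ≤ φ y →
      volume {t : ℝ | t ∈ Icc (0 : ℝ) 1 ∧ φ ((1 - t) • x + t • y) ≤ α} ≤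
        ENNReal.ofReal (4 * Real.exp (-s))) :
    ∃ M : ℝ, ∫⁻ x, ENNReal.ofReal |Real.log (φ x) - M|
      ∂((densityMeasure h univ)⁻¹ • densityMeasure h) ≤ ENNReal.ofReal (72 * d) := by
  set K := interior {x | 0 < h x} with hK
  set T := densityMeasure h univ with hT
  have hKc : Convex ℝ K := hh.convex_pos.interior
  let e : (Fin k → ℝ) → EuclideanSpace ℝ (Fin k) := WithLp.toLp 2
  have he : MeasurePreserving e := PiLp.volume_preserving_toLp (Fin k)
  have hlin : ∀ (t : ℝ) (x y : Fin k → ℝ), e ((1 - t) • x + t • y) = (1 - t) • e x + t • e y :=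
    fun t x y => rfl
  have hm : Measurable fun x => ENNReal.ofReal (K.indicator h x) :=
    ENNReal.measurable_ofReal.comp hh.measurable_indicator_interior
  have hint : ∀ G : EuclideanSpace ℝ (Fin k) → ℝ≥0∞, Measurable G →
      ∫⁻ x, G (e x) ∂(volume.withDensity fun x => T⁻¹ * ENNReal.ofReal (K.indicator h (e x))) =
        ∫⁻ x, G x ∂(T⁻¹ • densityMeasure h) := by
    intro G hG
    have hm' : Measurable fun x => ENNReal.ofReal (K.indicator h (e x)) := hm.comp he.measurable
    have hGe : Measurable fun x => G (e x) := hG.comp he.measurable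
    rw [lintegral_withDensity_eq_lintegral_mul _ (hm'.const_mul _) hGe, lintegral_smul_measure,
      hh.densityMeasure_eq, densityMeasure, lintegral_withDensity_eq_lintegral_mul _ hm hG,
      ← he.lintegral_comp (hm.mul hG), smul_eq_mul]
    simp only [Pi.mul_apply, mul_assoc]
    exact lintegral_const_mul _ (hm'.mul hGe)
  set p : (Fin k → ℝ) → ℝ≥0∞ := fun x => T⁻¹ * ENNReal.ofReal (K.indicator h (e x)) with hp
  have hpm : Measurable p := (hm.comp he.measurable).const_mul _
  have hp1 : ∫⁻ x, p x = 1 := by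
    have := hint 1 measurable_one
    simp only [Pi.one_apply, lintegral_one, Measure.smul_apply, smul_eq_mul, ← hT,
      withDensity_apply _ MeasurableSet.univ, Measure.restrict_univ] at this
    rw [this, ENNReal.inv_mul_cancel h0 h1]
  have hpK : ∀ x, p x ≠ 0 → e x ∈ K := fun x hx => by
    by_contra hxK
    exact hx (by simp [hp, hxK])
  have hpt : ∀ x, p x ≠ ∞ := fun x => ENNReal.mul_ne_top (ENNReal.inv_ne_top.2 h0) ENNReal.ofReal_ne_top
  have hlc : ∀ x y, ∀ t ∈ Icc (0 : ℝ) 1, p x ^ (1 - t) * p y ^ t ≤ p ((1 - t) • x + t • y) := by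
    intro x y t ht
    have t0 : 0 ≤ 1 - t := sub_nonneg.2 ht.2
    -- The endpoints are treated apart because 0 ^ 0 = 1: a vanishing density makes the left side
    -- zero only for exponents inside (0, 1).
    rcases ht.1.eq_or_lt with rfl | ht0
    · simp
    rcases ht.2.eq_or_lt with rfl | ht1
    · simp
    by_cases hx : p x = 0
    · simp [hx, ENNReal.zero_rpow_of_pos (sub_pos.2 ht1)]
    by_cases hy : p y = 0
    · simp [hy, ENNReal.zero_rpow_of_pos ht0]
    have hxK := hpK x hx
    have hyK := hpK y hy
    have hxp : 0 < h (e x) := interior_subset (s := {x | 0 < h x}) hxK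
    have hyp : 0 < h (e y) := interior_subset (s := {x | 0 < h x}) hyK
    have hzK : (1 - t) • e x + t • e y ∈ K := hKc hxK hyK t0 ht.1 (by ring)
    simp only [hp, hlin, indicator_of_mem hxK, indicator_of_mem hyK, indicator_of_mem hzK]
    -- The normalising constants combine to T^{-(1-t)} T^{-t} = T⁻¹, so normalisation preserves
    -- log-concavity.
    rw [ENNReal.mul_rpow_of_nonneg _ _ t0, ENNReal.mul_rpow_of_nonneg _ _ ht.1, mul_mul_mul_comm,
      ← ENNReal.rpow_add _ _ (ENNReal.inv_ne_zero.2 h1) (ENNReal.inv_ne_top.2 h0),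
      sub_add_cancel, ENNReal.rpow_one, ENNReal.ofReal_rpow_of_pos hxp,
      ENNReal.ofReal_rpow_of_pos hyp, ← ENNReal.ofReal_mul (by positivity)]
    gcongr
    exact hh.rpow_mul_rpow_le hxp hyp ht
  set ψ := K.indicator φ with hψ
  have hψm : Measurable ψ := measurable_indicator_of_continuousOn isOpen_interior.measurableSet hφ
  have hψ1 : ∀ᵐ x ∂(volume.withDensity p), ψ (e x) ≠ 0 := by
    have hS : MeasurableSet {x | ψ x = 0} := hψm (measurableSet_singleton 0)
    have := hint ({x | ψ x = 0}.indicator 1) (measurable_one.indicator hS)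
    rw [lintegral_indicator_one hS] at this
    have h2 : (T⁻¹ • densityMeasure h) {x | ψ x = 0} = 0 := by
      rw [Measure.smul_apply, smul_eq_mul, mul_eq_zero]
      right
      rw [measure_eq_zero_iff_ae_notMem]
      filter_upwards [hφ1, hh.ae_mem_interior] with x hx hxK hx0
      exact hx (by simpa [hψ, hK, hxK] using hx0)
    rw [h2] at this
    have hm2 : Measurable fun x => {x | ψ x = 0}.indicator (1 : EuclideanSpace ℝ (Fin k) → ℝ≥0∞) (e x) :=
      (measurable_one.indicator hS).comp he.measurable
    rw [lintegral_eq_zero_iff hm2] at this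
    filter_upwards [this] with x hx hx0
    simp [hx0] at hx
  have hψR : ∀ x y, p x ≠ 0 → p y ≠ 0 → ∀ α, 0 < α → ∀ s : ℝ, α * Real.exp (d * s) ≤ ψ (e y) →
      volume {t : ℝ | t ∈ Icc (0 : ℝ) 1 ∧ ψ (e ((1 - t) • x + t • y)) ≤ α} ≤
        ENNReal.ofReal (4 * Real.exp (-s)) := by
    intro x y hx hy α hα s hs
    have hxK := hpK x hx
    have hyK := hpK y hy
    simp only [hψ, indicator_of_mem hyK] at hs
    refine (measure_mono ?_).trans (hR (e x) hxK (e y) hyK α hα s hs)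
    rintro t ⟨ht, htα⟩
    refine ⟨ht, ?_⟩
    have hzK : (1 - t) • e x + t • e y ∈ K := hKc hxK hyK (sub_nonneg.2 ht.2) ht.1 (by ring)
    simpa only [hlin, hψ, indicator_of_mem hzK] using htα
  obtain ⟨M, hM⟩ := logConcave_mean_oscillation hpm hp1 hlc (φ := fun x => ψ (e x))
    (hψm.comp he.measurable) (fun x => indicator_nonneg (fun y _ => hφ0 y) _) hψ1 hd
    hψR
  refine ⟨M, ?_⟩
  have := hint (fun x => ENNReal.ofReal |Real.log (ψ x) - M|)
    (ENNReal.measurable_ofReal.comp ((Real.measurable_log.comp hψm).sub_const M).abs)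
  rw [this] at hM
  refine le_trans (le_of_eq ?_) hM
  rw [lintegral_smul_measure, lintegral_smul_measure]
  congr 1
  refine lintegral_congr_ae ?_
  filter_upwards [hh.ae_mem_interior] with x hx
  simp only [hψ, hK, indicator_of_mem hx]

/-! ### The main theorem. -/

theorem corollaryc2 :
    ∃ C : ℝ, 0 < C ∧
      ∀ (n k : ℕ)
        -- a `k`-dimensional real affine subspace of `ℂⁿ`, with Euclidean coordinates on it
        (ι : EuclideanSpace ℝ (Fin k) →ᵃⁱ[ℝ] EuclideanSpace ℂ (Fin n))
        (V : Set (EuclideanSpace ℝ (Fin k)))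
        (h : EuclideanSpace ℝ (Fin k) → ℝ)
        (r : ℝ) (f : EuclideanSpace ℂ (Fin n) → ℂ),
        Convex ℝ V → (interior V).Nonempty → ι '' V ⊆ ball 0 1 →
        IsLogConcave h → (∀ x, x ∉ V → h x = 0) →
        0 < densityMeasure h V → densityMeasure h V < ∞ →
        1 < r → DifferentiableOn ℂ f (ball 0 r) → (∃ x ∈ V, f (ι x) ≠ 0) →
        IntegrableOn (fun x => Real.log ‖f (ι x)‖) V (densityMeasure h) ∧
        ENNReal.ofReal
            (⨍ x in V, |Real.log ‖f (ι x)‖ -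
              ⨍ y in V, Real.log ‖f (ι y)‖ ∂(densityMeasure h)| ∂(densityMeasure h)) ≤
          ENNReal.ofReal C * chebyshevDegree f := by
  -- 72 from the oscillation around log β, doubled when centring at the mean.
  refine ⟨144, by norm_num, ?_⟩
  intro n k ι V h r f _ _ hVball hh hhV hV0 hV1 hr hf ⟨x₀, hx₀V, hx₀⟩
  set K := interior {x | 0 < h x} with hK
  have hKV : K ⊆ V := fun x hx => by
    by_contra hxV
    have : 0 < h x := interior_subset (s := {x | 0 < h x}) hx
    exact this.ne' (hhV x hxV)
  have hrestr : (densityMeasure h).restrict V = densityMeasure h :=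
    Measure.restrict_eq_self_of_ae_mem (hh.ae_mem_interior.mono fun x hx => hKV hx)
  have hVuniv : densityMeasure h V = densityMeasure h univ := by
    rw [← Measure.restrict_apply_univ, hrestr]
  rw [hVuniv] at hV0 hV1
  have hsub : ball (0 : EuclideanSpace ℂ (Fin n)) 1 ⊆ ball 0 r := ball_subset_ball hr.le
  have hVb : ∀ x ∈ V, ι x ∈ ball (0 : EuclideanSpace ℂ (Fin n)) 1 := fun x hx =>
    hVball (mem_image_of_mem ι hx)
  have hVbdd : Bornology.IsBounded V :=
    (ι.antilipschitz.isBounded_preimage isBounded_ball).subset hVb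
  have hcomp : IsCompact (closure V) := hVbdd.isCompact_closure
  -- Here r > 1 enters: f is holomorphic on a neighbourhood of the compact image of the closure of
  -- V, so local integrability covers all of V.
  have hclos : ∀ x ∈ closure V, ι x ∈ ball (0 : EuclideanSpace ℂ (Fin n)) r := fun x hx => by
    have h1 : ι x ∈ closure (ball (0 : EuclideanSpace ℂ (Fin n)) 1) :=
      map_mem_closure ι.continuous hx hVb
    exact closedBall_subset_ball hr (closure_ball_subset_closedBall h1)
  obtain ⟨hint, hzero⟩ := integrableOn_log_norm_of_isCompact volume isOpen_ball (convex_ball _ _)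
    hf ι (hsub (hVb x₀ hx₀V)) hx₀ hcomp hclos
  obtain ⟨B, hB⟩ := hh.exists_le hV0.ne' hV1.ne
  have hle := densityMeasure_le hB
  have hint' : IntegrableOn (fun x => Real.log ‖f (ι x)‖) V (densityMeasure h) := by
    have := (hint.mono_set subset_closure).integrable.smul_measure
      (ENNReal.ofReal_ne_top (r := B))
    refine this.mono_measure ?_
    rw [← Measure.restrict_smul]
    exact Measure.restrict_mono_measure hle V
  refine ⟨hint', ?_⟩
  have hint'' : Integrable (fun x => Real.log ‖f (ι x)‖) (densityMeasure h) := by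
    rw [← hrestr]; exact hint'
  rw [hrestr]
  set ν := (densityMeasure h univ)⁻¹ • densityMeasure h with hν
  have hprob : IsProbabilityMeasure ν := ⟨by
    rw [hν, Measure.smul_apply, smul_eq_mul, ENNReal.inv_mul_cancel hV0.ne' hV1.ne]⟩
  have hintν : Integrable (fun x => Real.log ‖f (ι x)‖) ν :=
    hint''.smul_measure (ENNReal.inv_ne_top.2 hV0.ne')
  have hac : densityMeasure h ≪ volume := withDensity_absolutelyContinuous _ _
  have hne : ∀ᵐ x ∂(densityMeasure h), ‖f (ι x)‖ ≠ 0 := by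
    filter_upwards [hac (measure_eq_zero_iff_ae_notMem.1 hzero), hh.ae_mem_interior] with x hx hxK h0
    exact hx ⟨subset_closure (hKV hxK), norm_eq_zero.1 h0⟩
  have hfK : ContinuousOn (fun x => ‖f (ι x)‖) K :=
    (hf.continuousOn.comp ι.continuous.continuousOn fun x hx => hsub (hVb x (hKV hx))).norm
  have key : ∀ d : ℝ≥0, 0 < d → RemezInequality f d →
      ∫ x, |Real.log ‖f (ι x)‖ - ∫ y, Real.log ‖f (ι y)‖ ∂ν| ∂ν ≤ 144 * d := by
    intro d hd hR
    obtain ⟨M, hM⟩ := mean_oscillation_le_of_remez hh hV0.ne' hV1.ne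
      (φ := fun x => ‖f (ι x)‖) (fun x => norm_nonneg _) hfK hne (NNReal.coe_pos.2 hd)
      (fun x hx y hy α hα s hs => by
        have := hR.volume_sublevel_le hd (hf.continuousOn.mono hsub) (hVb x (hKV hx))
          (hVb y (hKV hy)) hα hs
        refine le_trans (measure_mono ?_) this
        rintro t ⟨ht, hα⟩
        refine ⟨ht, ?_⟩
        rw [← AffineMap.lineMap_apply_module (k := ℝ)] at hα
        have hl := ι.toAffineMap.apply_lineMap x y t
        simp only [AffineIsometry.coe_toAffineMap] at hl
        rwa [← hl])
    refine (integral_abs_sub_integral_le hintν (by positivity) hM).trans (le_of_eq (by ring))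
  have hC0 : ENNReal.ofReal 144 ≠ 0 := by simp
  rw [mul_comm, ← ENNReal.div_le_iff_le_mul (.inl hC0) (.inl ENNReal.ofReal_ne_top)]
  -- It suffices to treat each admissible exponent; if there is none the infimum is ∞.
  refine le_iInf₂ fun d hd => ?_
  rw [ENNReal.div_le_iff_le_mul (.inl hC0) (.inl ENNReal.ofReal_ne_top), mul_comm]
  refine (ENNReal.ofReal_le_ofReal (key d hd.1 hd.2)).trans (le_of_eq ?_)
  rw [ENNReal.ofReal_mul (by norm_num), ENNReal.ofReal_coe_nnreal]
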